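/- Let $F$ be a field which is complete with respect to a non-trivial non-Archimedean absolute value $|\cdot|$, let $\pi\in F$ be a pseudo-uniformiser ($0<|\pi|<1$), let $F^{\circ}=\{x\in F:|x|\le 1\}$, and let $m,d\in\mathbb{N}$. An $F^{\circ}$-Banach module is an $F^{\circ}$-module $M$ which is complete for a non-Archimedean norm satisfying $\|rx\|\le C|r|\|x\|$ for some constant $C$ (depending on $M$); morphisms are the bounded $F^{\circ}$-linear maps. Let $\mathbf{IndBan}_{F^{\circ}}$ be the category of ind-objects of the category of $F^{\circ}$-Banach modules. For an $F^{\circ}$-Banach module $M$, the internal homomorphisms are $\underline{\mathrm{Hom}}_{F^{\circ}}(M,\text{“}\varinjlim_i\text{”}V_i)=\text{“}\varinjlim_i\text{”}\underline{\mathrm{Hom}}_{F^{\circ}}(M,V_i)$, where $\underline{\mathrm{Hom}}_{F^{\circ}}(M,V_i)$ is the module of bounded $F^{\circ}$-linear maps with the norm $\|\phi\|=\sup_{x\neq0}\|\phi(x)\|/\|x\|$. Let $\mathrm{D}(\mathbf{IndBan}_{F^{\circ}})$ be the derived category of the quasi-abelian category $\mathbf{IndBan}_{F^{\circ}}$, that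 is, the localisation of the homotopy category of unbounded complexes at the morphisms with strictly exact cone, with its left t-structure: $\mathrm{D}^{\le0}$ (respectively $\mathrm{D}^{\ge0}$) consists of the complexes which are strictly exact in all degrees $>0$ (respectively $<0$). Let $\mathrm{LH}=\mathrm{D}^{\le0}\cap\mathrm{D}^{\ge0}$ be the left heart, $\mathrm{LH}^{0}=\tau^{\ge0}\tau^{\le0}\colon\mathrm{D}(\mathbf{IndBan}_{F^{\circ}})\to\mathrm{LH}$ its cohomology functor, and $\mathrm{I}\colon\mathbf{IndBan}_{F^{\circ}}\to\mathrm{LH}$ the functor sending an object to the complex concentrated in degree $0$. Since $\mathrm{I}(F^{\circ})$ is the unit of the closed symmetric monoidal category $\mathrm{LH}$, $\mathrm{LH}$ is the category $\mathbf{IndBan}_{\mathrm{I}(F^{\circ})}$ of $\mathrm{I}(F^{\circ})$-modules in it. For an $F^{\circ}$-Banach module $M$, put $$\underline{\mathrm{Hom}}_{\mathrm{I}(F^{\circ})}(\mathrm{I}(M),V):=\mathrm{LH}^{0}\left(\mathrm{R}\underline{\mathrm{Hom}}_{F^{\circ}}(M,V)\right),\qquad V\in\mathrm{LH},$$ where $\mathrm{R}\underline{\mathrm{Hom}}_{F^{\circ}}(M,-)$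 is the total right derived functor of the termwise functor $\underline{\mathrm{Hom}}_{F^{\circ}}(M,-)$ on complexes. Finally, with $X=(X_1,\dots,X_d)$, let $F^{\circ}\left\langle\frac{X}{\pi^m}\right\rangle$ be the $F^{\circ}$-Banach module of power series $\sum_{\alpha\in\mathbb{N}^d}f_\alpha\left(\frac{X}{\pi^m}\right)^{\alpha}$ with $f_\alpha\in F^{\circ}$ and $f_\alpha\to0$, with the norm $\sup_\alpha|f_\alpha|$. **Proposition.** The endofunctor $$\underline{\mathrm{Hom}}_{\mathrm{I}(F^{\circ})}\left(\mathrm{I}\left(F^{\circ}\left\langle\tfrac{X}{\pi^m}\right\rangle\right),-\right)\colon\mathrm{LH}\to\mathrm{LH}$$ exists and is exact, i.e. it preserves finite limits and finite colimits. -/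

import Mathlib

open CategoryTheory CategoryTheory.Limits Filter Topology

universe u

noncomputable section

namespace IndBanach

/-! ### Banach modules over a normed ring -/

/-- A non-Archimedean Banach module over `R`: a complete ultrametric normed abelian group with an
`R`-action which is bounded, `‖r • x‖ ≤ C ‖r‖ ‖x‖`. -/
structure BanMod (R : Type u) [NormedCommRing R] : Type (u + 1) where
  carrier : Type u
  [normed : NormedAddCommGroup carrier]
  [module : Module R carrier]
  [ultrametric : IsUltrametricDist carrier]
  [complete : CompleteSpace carrier]
  bounded_smul : ∃ C : ℝ, 0 < C ∧ ∀ (r : R) (x : carrier), ‖r • x‖ ≤ C * ‖r‖ * ‖x‖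

instance (R : Type u) [NormedCommRing R] : CoeSort (BanMod R) (Type u) := ⟨BanMod.carrier⟩

attribute [instance] BanMod.normed BanMod.module BanMod.ultrametric BanMod.complete

variable {R : Type u} [NormedCommRing R]

instance (M : BanMod R) : ContinuousConstSMul R M where
  continuous_const_smul r := by
    obtain ⟨C, -, hC⟩ := M.bounded_smul
    exact AddMonoidHomClass.continuous_of_bound (DistribSMul.toAddMonoidHom M r) (C * ‖r‖)
      (fun x => hC r x)

/-- The `R`-module of bounded `R`-linear maps. -/
def boundedMaps (M N : BanMod R) : Submodule R (M →ₗ[R] N) where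
  carrier := {f | ∃ C : ℝ, ∀ x, ‖f x‖ ≤ C * ‖x‖}
  zero_mem' := ⟨0, by simp⟩
  add_mem' := by
    rintro f g ⟨C, hC⟩ ⟨D, hD⟩
    refine ⟨C + D, fun x => ?_⟩
    calc ‖(f + g) x‖ ≤ ‖f x‖ + ‖g x‖ := norm_add_le _ _
      _ ≤ (C + D) * ‖x‖ := by rw [add_mul]; exact add_le_add (hC x) (hD x)
  smul_mem' := by
    rintro r f ⟨C, hC⟩
    obtain ⟨K, hK, hb⟩ := N.bounded_smul
    refine ⟨K * ‖r‖ * C, fun x => ?_⟩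
    calc ‖(r • f) x‖ ≤ K * ‖r‖ * ‖f x‖ := hb r (f x)
      _ ≤ K * ‖r‖ * (C * ‖x‖) := by gcongr; exact hC x
      _ = _ := by ring

/-! The category of Banach modules and bounded linear maps. The morphisms are placed in the
universe of the objects, so that this is a small category there. -/

/-- Morphisms of Banach modules: bounded linear maps. -/
@[ext]
structure BanMod.Hom (M N : BanMod R) : Type (u + 1) where
  toLin : M →ₗ[R] N
  bounded : ∃ C : ℝ, ∀ x, ‖toLin x‖ ≤ C * ‖x‖

instance : Category.{u + 1} (BanMod R) where
  Hom := BanMod.Hom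
  id M := ⟨LinearMap.id, 1, fun x => by simp⟩
  comp f g := ⟨g.toLin ∘ₗ f.toLin, by
    obtain ⟨C, hC⟩ := f.bounded
    obtain ⟨D, hD⟩ := g.bounded
    refine ⟨|D| * C, fun x => ?_⟩
    calc ‖g.toLin (f.toLin x)‖ ≤ D * ‖f.toLin x‖ := hD _
      _ ≤ |D| * ‖f.toLin x‖ := by gcongr; exact le_abs_self D
      _ ≤ |D| * (C * ‖x‖) := by gcongr; exact hC x
      _ = _ := by ring⟩

namespace BanMod

@[ext]
lemma hom_ext {M N : BanMod R} {f g : M ⟶ N} (h : ∀ x, f.toLin x = g.toLin x) : f = g :=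
  Hom.ext (LinearMap.ext h)

@[simp] lemma id_toLin (M : BanMod R) : Hom.toLin (𝟙 M) = LinearMap.id := rfl

@[simp] lemma comp_toLin {M N P : BanMod R} (f : M ⟶ N) (g : N ⟶ P) :
    (f ≫ g).toLin = g.toLin ∘ₗ f.toLin := rfl

/-- Morphisms are the elements of the module of bounded maps. -/
def homEquiv (M N : BanMod R) : (M ⟶ N) ≃ boundedMaps M N where
  toFun f := ⟨f.toLin, f.bounded⟩
  invFun f := ⟨f.1, f.2⟩
  left_inv _ := rfl
  right_inv _ := rfl

instance (M N : BanMod R) : AddCommGroup (M ⟶ N) := (homEquiv M N).addCommGroup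

@[simp] lemma add_toLin {M N : BanMod R} (f g : M ⟶ N) : (f + g).toLin = f.toLin + g.toLin := rfl
@[simp] lemma zero_toLin {M N : BanMod R} : (0 : M ⟶ N).toLin = 0 := rfl
@[simp] lemma sub_toLin {M N : BanMod R} (f g : M ⟶ N) : (f - g).toLin = f.toLin - g.toLin := rfl

instance : Preadditive (BanMod R) where
  add_comp _ _ _ f f' g := by ext x; simp
  comp_add _ _ _ f g g' := by ext x; simp

lemma Hom.continuous {M N : BanMod R} (f : M ⟶ N) : Continuous f.toLin := by
  obtain ⟨C, hC⟩ := f.bounded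
  exact AddMonoidHomClass.continuous_of_bound f.toLin C hC

instance : HasZeroObject (BanMod R) where
  zero := by
    refine ⟨{ carrier := PUnit, ultrametric := ⟨fun x y z => by simp⟩, bounded_smul := ⟨1, one_pos, fun r x => by simp⟩ }, ?_⟩
    rw [IsZero.iff_id_eq_zero]
    ext x

/-- The direct sum of two Banach modules, with the maximum norm. -/
def prod (M N : BanMod R) : BanMod R where
  carrier := M × N
  ultrametric := IsUltrametricDist.isUltrametricDist_of_forall_norm_add_le_max_norm (by
    rintro ⟨a, b⟩ ⟨c, d⟩
    have h1 := IsUltrametricDist.norm_add_le_max a c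
    have h2 := IsUltrametricDist.norm_add_le_max b d
    simp only [Prod.norm_def, Prod.mk_add_mk]
    grind)
  bounded_smul := by
    obtain ⟨C, hC, hM⟩ := M.bounded_smul
    obtain ⟨D, hD, hN⟩ := N.bounded_smul
    refine ⟨max C D, by positivity, fun r x => ?_⟩
    rw [Prod.norm_def]
    refine max_le ((hM r x.1).trans ?_) ((hN r x.2).trans ?_)
    · gcongr
      · exact le_max_left _ _
      · exact norm_fst_le x
    · gcongr
      · exact le_max_right _ _
      · exact norm_snd_le x

instance : HasBinaryBiproducts (BanMod R) where
  has_binary_biproduct M N := by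
    let b : BinaryBicone M N :=
      { pt := prod M N
        fst := ⟨LinearMap.fst R M N, 1, fun x => by rw [one_mul]; exact norm_fst_le x⟩
        snd := ⟨LinearMap.snd R M N, 1, fun x => by rw [one_mul]; exact norm_snd_le x⟩
        inl := ⟨LinearMap.inl R M N, 1, fun x => by
          change ‖((x, 0) : M × N)‖ ≤ _
          simp [Prod.norm_def]⟩
        inr := ⟨LinearMap.inr R M N, 1, fun x => by
          change ‖((0, x) : M × N)‖ ≤ _
          simp [Prod.norm_def]⟩
        inl_fst := rfl
        inl_snd := rfl
        inr_fst := rfl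
        inr_snd := rfl }
    refine HasBinaryBiproduct.mk ⟨b, isBinaryBilimitOfTotal b ?_⟩
    ext ⟨x, y⟩
    change ((x, 0) + (0, y) : M × N) = (x, y)
    simp

/-- The kernel, with the restricted norm. -/
def ker {M N : BanMod R} (f : M ⟶ N) : BanMod R where
  carrier := LinearMap.ker f.toLin
  ultrametric := inferInstanceAs (IsUltrametricDist (Subtype _))
  complete := by
    have : IsClosed ((LinearMap.ker f.toLin : Submodule R M) : Set M) :=
      isClosed_singleton.preimage (Hom.continuous f)
    exact this.completeSpace_coe
  bounded_smul := by
    obtain ⟨C, hC, hM⟩ := M.bounded_smul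
    exact ⟨C, hC, fun r x => hM r x.1⟩

instance : HasKernels (BanMod R) where
  has_limit {M N} f := by
    let i : ker f ⟶ M := ⟨(LinearMap.ker f.toLin).subtype, 1, fun x => by
      rw [one_mul]; exact le_rfl⟩
    have w : i ≫ f = 0 := by ext x; exact x.2
    refine ⟨⟨⟨KernelFork.ofι i w, KernelFork.IsLimit.ofι i w
      (fun {W} g hg => ⟨LinearMap.codRestrict _ g.toLin
        (fun x => LinearMap.congr_fun (congrArg Hom.toLin hg) x), g.bounded⟩) ?_ ?_⟩⟩⟩
    · intros; rfl
    · intro W g hg m hm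
      ext x
      apply Subtype.ext
      exact LinearMap.congr_fun (congrArg Hom.toLin hm) x

/-- The cokernel `N / closure (f M)`, with the residue norm. -/
def coker {M N : BanMod R} (f : M ⟶ N) : BanMod R :=
  letI : IsClosed (((LinearMap.range f.toLin).topologicalClosure : Submodule R N) : Set N) :=
    Submodule.isClosed_topologicalClosure _
  { carrier := N ⧸ (LinearMap.range f.toLin).topologicalClosure
    normed := Submodule.Quotient.normedAddCommGroup _
    complete := Submodule.Quotient.completeSpace _
    ultrametric := by
      refine IsUltrametricDist.isUltrametricDist_of_forall_norm_add_le_max_norm fun x y => ?_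
      refine le_of_forall_pos_lt_add fun ε hε => ?_
      obtain ⟨a, rfl, ha⟩ := Submodule.Quotient.norm_mk_lt x hε
      obtain ⟨b, rfl, hb⟩ := Submodule.Quotient.norm_mk_lt y hε
      have h1 : ‖(Submodule.Quotient.mk (a + b) :
          N ⧸ (LinearMap.range f.toLin).topologicalClosure)‖ ≤ ‖a + b‖ :=
        Submodule.Quotient.norm_mk_le _ _
      rw [← Submodule.Quotient.mk_add]
      have h2 := IsUltrametricDist.norm_add_le_max a b
      rw [← max_add_add_right]
      refine (h1.trans h2).trans_lt ?_
      exact max_lt_max ha hb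
    bounded_smul := by
      obtain ⟨C, hC, hN⟩ := N.bounded_smul
      refine ⟨C, hC, fun r x => ?_⟩
      refine le_of_forall_pos_le_add fun ε hε => ?_
      obtain ⟨a, rfl, ha⟩ := Submodule.Quotient.norm_mk_lt x
        (show 0 < ε / (C * ‖r‖ + 1) by positivity)
      have h1 : ‖(Submodule.Quotient.mk (r • a) :
          N ⧸ (LinearMap.range f.toLin).topologicalClosure)‖ ≤ ‖r • a‖ :=
        Submodule.Quotient.norm_mk_le _ _
      rw [← Submodule.Quotient.mk_smul]
      refine (h1.trans (hN r a)).trans ?_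
      calc C * ‖r‖ * ‖a‖ ≤ C * ‖r‖ * (‖(Submodule.Quotient.mk a :
            N ⧸ (LinearMap.range f.toLin).topologicalClosure)‖ + ε / (C * ‖r‖ + 1)) := by
              gcongr
        _ = C * ‖r‖ * ‖(Submodule.Quotient.mk a :
            N ⧸ (LinearMap.range f.toLin).topologicalClosure)‖
              + ε * ((C * ‖r‖) / (C * ‖r‖ + 1)) := by ring
        _ ≤ _ := by
          refine add_le_add le_rfl (mul_le_of_le_one_right hε.le ?_)
          rw [div_le_one (by positivity)]
          linarith }

instance : HasCokernels (BanMod R) where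
  has_colimit {M N} f := by
    let S := (LinearMap.range f.toLin).topologicalClosure
    let p : N ⟶ coker f := ⟨S.mkQ, 1, fun x => by
      rw [one_mul]; exact Submodule.Quotient.norm_mk_le _ _⟩
    have w : f ≫ p = 0 := by
      ext x
      exact (Submodule.Quotient.mk_eq_zero S).2
        (Submodule.le_topologicalClosure _ ⟨x, rfl⟩)
    refine ⟨⟨⟨CokernelCofork.ofπ p w, CokernelCofork.IsColimit.ofπ p w
      (fun {W} g hg => ⟨S.liftQ g.toLin ?_, ?_⟩) ?_ ?_⟩⟩⟩
    · refine Submodule.topologicalClosure_minimal _ ?_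
        (isClosed_singleton.preimage (Hom.continuous g))
      rintro _ ⟨x, rfl⟩
      exact LinearMap.congr_fun (congrArg Hom.toLin hg) x
    · obtain ⟨C, hC⟩ := g.bounded
      refine ⟨|C|, fun x => ?_⟩
      refine le_of_forall_pos_le_add fun ε hε => ?_
      obtain ⟨a, rfl, ha⟩ := Submodule.Quotient.norm_mk_lt (S := S) x
        (show 0 < ε / (|C| + 1) by positivity)
      calc ‖g.toLin a‖ ≤ C * ‖a‖ := hC a
        _ ≤ |C| * ‖a‖ := by gcongr; exact le_abs_self C
        _ ≤ |C| * (‖(Submodule.Quotient.mk a : N ⧸ S)‖ + ε / (|C| + 1)) := by gcongr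
        _ = |C| * ‖(Submodule.Quotient.mk a : N ⧸ S)‖ + ε * (|C| / (|C| + 1)) := by ring
        _ ≤ _ := by
          refine add_le_add le_rfl (mul_le_of_le_one_right hε.le ?_)
          rw [div_le_one (by positivity)]
          linarith
    · intros; rfl
    · intro W g hg m hm
      ext x
      obtain ⟨a, rfl⟩ := S.mkQ_surjective x
      exact LinearMap.congr_fun (congrArg Hom.toLin hm) a

instance : HasFiniteProducts (BanMod R) :=
  letI := HasZeroObject.hasTerminal (C := BanMod R)
  hasFiniteProducts_of_has_binary_and_terminal

instance : HasFiniteCoproducts (BanMod R) :=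
  letI := HasZeroObject.hasInitial (C := BanMod R)
  hasFiniteCoproducts_of_has_binary_and_initial

instance : HasFiniteLimits (BanMod R) :=
  letI := Preadditive.hasEqualizers_of_hasKernels (C := BanMod R)
  hasFiniteLimits_of_hasEqualizers_and_finite_products

instance : HasFiniteColimits (BanMod R) :=
  letI := Preadditive.hasCoequalizers_of_hasCokernels (C := BanMod R)
  hasFiniteColimits_of_hasCoequalizers_and_finite_coproducts

/-- A criterion for completeness of a space of functions with a weighted supremum norm. -/
lemma completeSpace_of_eval {V : Type*} [NormedAddCommGroup V] {ι : Type*} {W : ι → Type*}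
    [∀ i, NormedAddCommGroup (W i)] [∀ i, CompleteSpace (W i)] (e : ∀ i, V →+ W i) (w : ι → ℝ)
    (hn : ∀ v c, 0 ≤ c → (‖v‖ ≤ c ↔ ∀ i, ‖e i v‖ ≤ c * w i))
    (lim : ∀ y : ∀ i, W i, (∀ ε > 0, ∃ v, ∀ i, ‖e i v - y i‖ ≤ ε * w i) → ∃ v, ∀ i, e i v = y i) :
    CompleteSpace V := by
  refine Metric.complete_of_cauchySeq_tendsto fun v hv => ?_
  have hle : ∀ x i, ‖e i x‖ ≤ ‖x‖ * w i := fun x => (hn x _ (norm_nonneg _)).1 le_rfl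
  have hcau : ∀ i, CauchySeq fun n => e i (v n) := fun i =>
    (AddMonoidHomClass.lipschitz_of_bound (e i) (w i)
      (fun x => by rw [mul_comm]; exact hle x i)).uniformContinuous.comp_cauchySeq hv
  choose y hy using fun i => cauchySeq_tendsto_of_complete (hcau i)
  have key : ∀ ε > 0, ∃ N, ∀ n ≥ N, ∀ i, ‖e i (v n) - y i‖ ≤ ε * w i := by
    intro ε hε
    obtain ⟨N, hN⟩ := Metric.cauchySeq_iff.1 hv ε hε
    refine ⟨N, fun n hn' i => ?_⟩
    refine le_of_tendsto ((tendsto_const_nhds.sub (hy i)).norm) ?_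
    filter_upwards [eventually_ge_atTop N] with k hk
    rw [← map_sub]
    refine (hn _ ε hε.le).1 ?_ i
    rw [← dist_eq_norm]
    exact (hN n hn' k hk).le
  obtain ⟨z, hz⟩ := lim y fun ε hε => by
    obtain ⟨N, hN⟩ := key ε hε
    exact ⟨v N, hN N le_rfl⟩
  refine ⟨z, Metric.tendsto_atTop.2 fun ε hε => ?_⟩
  obtain ⟨N, hN⟩ := key (ε / 2) (half_pos hε)
  refine ⟨N, fun n hn' => ?_⟩
  rw [dist_eq_norm]
  refine lt_of_le_of_lt ((hn _ (ε / 2) (half_pos hε).le).2 fun i => ?_) (half_lt_self hε)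
  rw [map_sub, hz]
  exact hN n hn' i

/-! ### The internal homomorphisms of Banach modules -/

/-- The operator norm `sup_{x ≠ 0} ‖f x‖ / ‖x‖`. -/
def opNorm {M N : BanMod R} (f : boundedMaps M N) : ℝ := ⨆ x : M, ‖f.1 x‖ / ‖x‖

lemma opNorm_le_iff {M N : BanMod R} (f : boundedMaps M N) {c : ℝ} (hc : 0 ≤ c) :
    opNorm f ≤ c ↔ ∀ x, ‖f.1 x‖ ≤ c * ‖x‖ := by
  have h0 : ∀ x, ∀ d, 0 ≤ d → (‖f.1 x‖ / ‖x‖ ≤ d ↔ ‖f.1 x‖ ≤ d * ‖x‖) := by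
    intro x d hd
    by_cases hx : x = 0
    · simp [hx, hd]
    · rw [div_le_iff₀ (norm_pos_iff.2 hx)]
  constructor
  · intro h x
    rw [← h0 x c hc]
    refine le_trans (le_ciSup (f := fun x : M => ‖f.1 x‖ / ‖x‖) ?_ x) h
    obtain ⟨C, hC⟩ := f.2
    refine ⟨|C|, ?_⟩
    rintro _ ⟨y, rfl⟩
    refine (h0 y _ (abs_nonneg C)).2 ((hC y).trans ?_)
    gcongr
    exact le_abs_self C
  · intro h
    exact ciSup_le fun x => (h0 x c hc).2 (h x)

lemma opNorm_nonneg {M N : BanMod R} (f : boundedMaps M N) : 0 ≤ opNorm f :=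
  Real.iSup_nonneg fun x => by positivity

lemma le_opNorm {M N : BanMod R} (f : boundedMaps M N) (x : M) : ‖f.1 x‖ ≤ opNorm f * ‖x‖ :=
  (opNorm_le_iff f (opNorm_nonneg f)).1 le_rfl x

lemma opNorm_add_le_max {M N : BanMod R} (f g : boundedMaps M N) :
    opNorm (f + g) ≤ max (opNorm f) (opNorm g) := by
  refine (opNorm_le_iff _ (le_max_of_le_left (opNorm_nonneg f))).2 fun x => ?_
  refine (IsUltrametricDist.norm_add_le_max (f.1 x) (g.1 x)).trans ?_
  rw [max_mul_of_nonneg _ _ (norm_nonneg x)]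
  exact max_le_max (le_opNorm f x) (le_opNorm g x)

instance (M N : BanMod R) : NormedAddCommGroup (boundedMaps M N) :=
  AddGroupNorm.toNormedAddCommGroup
    { toFun := opNorm
      map_zero' := le_antisymm ((opNorm_le_iff _ le_rfl).2 fun x => by simp) (opNorm_nonneg _)
      add_le' := fun f g => (opNorm_add_le_max f g).trans
        (max_le_add_of_nonneg (opNorm_nonneg f) (opNorm_nonneg g))
      neg' := fun f => by
        unfold opNorm
        congr 1
        ext x
        simp
      eq_zero_of_map_eq_zero' := fun f hf => by
        ext x
        have := le_opNorm f x
        change opNorm f = 0 at hf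
        rw [hf, zero_mul] at this
        exact norm_le_zero_iff.1 this }

/-- The Banach module of bounded linear maps `M → N`, with the operator norm. -/
def ihom (M N : BanMod R) : BanMod R where
  carrier := boundedMaps M N
  ultrametric :=
    IsUltrametricDist.isUltrametricDist_of_forall_norm_add_le_max_norm opNorm_add_le_max
  complete := by
    refine completeSpace_of_eval (ι := M) (W := fun _ => N)
      (fun x => { toFun := fun f => f.1 x, map_zero' := rfl, map_add' := fun _ _ => rfl })
      (fun x => ‖x‖) (fun f c hc => opNorm_le_iff f hc) fun y hy => ?_
    change ∀ ε > 0, ∃ v : boundedMaps M N, ∀ x, ‖v.1 x - y x‖ ≤ ε * ‖x‖ at hy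
    obtain ⟨C, hC, hN⟩ := N.bounded_smul
    refine ⟨⟨{ toFun := y, map_add' := fun a b => ?_, map_smul' := fun r a => ?_ }, ?_⟩,
      fun _ => rfl⟩
    · rw [← sub_eq_zero, ← norm_le_zero_iff]
      refine le_of_forall_pos_le_add fun ε hε => ?_
      have hK : 0 < ‖a + b‖ + ‖a‖ + ‖b‖ + 1 := by positivity
      obtain ⟨v, hv⟩ := hy (ε / (‖a + b‖ + ‖a‖ + ‖b‖ + 1)) (by positivity)
      have e : y (a + b) - (y a + y b)
          = -(v.1 (a + b) - y (a + b)) + ((v.1 a - y a) + (v.1 b - y b)) := by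
        rw [map_add]; abel
      rw [e]
      refine (norm_add_le _ _).trans ?_
      rw [norm_neg]
      refine (add_le_add (hv _) ((norm_add_le _ _).trans (add_le_add (hv a) (hv b)))).trans ?_
      rw [← mul_add, ← mul_add, div_mul_eq_mul_div, zero_add, div_le_iff₀ hK]
      exact mul_le_mul_of_nonneg_left (by linarith) hε.le
    · rw [← sub_eq_zero, ← norm_le_zero_iff]
      refine le_of_forall_pos_le_add fun ε hε => ?_
      have hK : 0 < ‖r • a‖ + C * ‖r‖ * ‖a‖ + 1 := by positivity
      obtain ⟨v, hv⟩ := hy (ε / (‖r • a‖ + C * ‖r‖ * ‖a‖ + 1)) (by positivity)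
      have e : y (r • a) - (RingHom.id R) r • y a
          = -(v.1 (r • a) - y (r • a)) + r • (v.1 a - y a) := by
        rw [map_smul, smul_sub, RingHom.id_apply]; abel
      rw [e]
      refine (norm_add_le _ _).trans ?_
      rw [norm_neg]
      refine (add_le_add (hv _) ((hN r _).trans
        (mul_le_mul_of_nonneg_left (hv a) (by positivity)))).trans ?_
      rw [zero_add, mul_left_comm, ← mul_add, div_mul_eq_mul_div, div_le_iff₀ hK]
      exact mul_le_mul_of_nonneg_left (by linarith) hε.le
    · obtain ⟨v, hv⟩ := hy 1 one_pos
      refine ⟨opNorm v + 1, fun x => ?_⟩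
      have e : y x = v.1 x - (v.1 x - y x) := by abel
      change ‖y x‖ ≤ _
      rw [e, add_mul]
      exact (norm_sub_le _ _).trans (add_le_add (le_opNorm v x) (hv x))
  bounded_smul := by
    obtain ⟨C, hC, hN⟩ := N.bounded_smul
    refine ⟨C, hC, fun r f => ?_⟩
    refine (opNorm_le_iff _ (mul_nonneg (by positivity) (norm_nonneg f))).2 fun x => ?_
    calc ‖r • f.1 x‖ ≤ C * ‖r‖ * ‖f.1 x‖ := hN r (f.1 x)
      _ ≤ C * ‖r‖ * (‖f‖ * ‖x‖) := mul_le_mul_of_nonneg_left (le_opNorm f x) (by positivity)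
      _ = _ := by ring

/-- Post-composition with a bounded linear map. -/
def ihomMap (M : BanMod R) {N P : BanMod R} (g : N ⟶ P) : ihom M N ⟶ ihom M P where
  toLin := LinearMap.restrict (LinearMap.compRight R g.toLin) (p := boundedMaps M N)
    (q := boundedMaps M P) (fun f hf => ((homEquiv M N).symm ⟨f, hf⟩ ≫ g).bounded)
  bounded := by
    obtain ⟨D, hD⟩ := g.bounded
    refine ⟨|D|, fun f => ?_⟩
    refine (opNorm_le_iff _ (mul_nonneg (abs_nonneg D) (norm_nonneg f))).2 fun x => ?_
    calc ‖g.toLin (f.1 x)‖ ≤ D * ‖f.1 x‖ := hD _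
      _ ≤ |D| * ‖f.1 x‖ := by gcongr; exact le_abs_self D
      _ ≤ |D| * (‖f‖ * ‖x‖) := mul_le_mul_of_nonneg_left (le_opNorm f x) (abs_nonneg D)
      _ = _ := by ring

/-- The internal hom functor of Banach modules out of `M`. -/
def ihomFunctor (M : BanMod R) : BanMod R ⥤ BanMod R where
  obj N := ihom M N
  map g := ihomMap M g
  map_id _ := rfl
  map_comp _ _ := rfl

instance (M : BanMod R) : (ihomFunctor M).Additive where
  map_add {N P g h} := by
    ext f
    rfl

end BanMod

/-! ### Ind-Banach modules -/

/-- The category of ind-objects of the category of Banach modules. -/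
abbrev IndBan (R : Type u) [NormedCommRing R] := Ind (BanMod R)

instance : (Ind.yoneda (C := BanMod R)).Additive :=
  Functor.additive_of_preserves_binary_products _

/-- The internal hom functor of ind-Banach modules out of a Banach module `M`,
`“colim” V_i ↦ “colim” Hom(M, V_i)`. -/
def IndBan.ihomFunctor (M : BanMod R) : IndBan R ⥤ IndBan R :=
  Ind.yoneda.pointwiseLeftKanExtension (BanMod.ihomFunctor M ⋙ Ind.yoneda)

namespace IndBan

/-- The structure morphism `Hom(M, A) ⟶ Hom(M, V)` attached to `a : A ⟶ V`. -/
def ι (M : BanMod R) {V : IndBan R} {A : BanMod R} (a : Ind.yoneda.obj A ⟶ V) :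
    Ind.yoneda.obj ((BanMod.ihomFunctor M).obj A) ⟶ (ihomFunctor M).obj V :=
  colimit.ι (CostructuredArrow.proj Ind.yoneda V ⋙ BanMod.ihomFunctor M ⋙ Ind.yoneda)
    (CostructuredArrow.mk a)

lemma ι_map (M : BanMod R) {V W : IndBan R} {A : BanMod R} (a : Ind.yoneda.obj A ⟶ V)
    (f : V ⟶ W) : ι M a ≫ (ihomFunctor M).map f = ι M (a ≫ f) :=
  colimit.ι_desc _ _

lemma map_ι (M : BanMod R) {V : IndBan R} {A B : BanMod R} (k : A ⟶ B)
    (b : Ind.yoneda.obj B ⟶ V) (a : Ind.yoneda.obj A ⟶ V) (h : Ind.yoneda.map k ≫ b = a) :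
    Ind.yoneda.map ((BanMod.ihomFunctor M).map k) ≫ ι M b = ι M a :=
  colimit.w (CostructuredArrow.proj Ind.yoneda V ⋙ BanMod.ihomFunctor M ⋙ Ind.yoneda)
    (CostructuredArrow.homMk k h : CostructuredArrow.mk a ⟶ CostructuredArrow.mk b)

lemma ihom_hom_ext (M : BanMod R) {V W : IndBan R} {f g : (ihomFunctor M).obj V ⟶ W}
    (h : ∀ (A : BanMod R) (a : Ind.yoneda.obj A ⟶ V), ι M a ≫ f = ι M a ≫ g) : f = g :=
  colimit.hom_ext fun j => h j.left j.hom

lemma ι_add (M : BanMod R) {W : IndBan R} {A : BanMod R} (a b : Ind.yoneda.obj A ⟶ W) :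
    ι M (a + b) = ι M a + ι M b := by
  have : IsFiltered (CostructuredArrow (Ind.yoneda (C := BanMod R)) W) :=
    RepresentablyCoflat.filtered W
  obtain ⟨B, k, l, c, hk, hl⟩ : ∃ (B : BanMod R) (k l : A ⟶ B) (c : Ind.yoneda.obj B ⟶ W),
      Ind.yoneda.map k ≫ c = a ∧ Ind.yoneda.map l ≫ c = b :=
    ⟨_, (IsFiltered.leftToMax (CostructuredArrow.mk a) (CostructuredArrow.mk b)).left,
      (IsFiltered.rightToMax (CostructuredArrow.mk a) (CostructuredArrow.mk b)).left, _,
      CostructuredArrow.w _, CostructuredArrow.w _⟩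
  rw [← map_ι M k c a hk, ← map_ι M l c b hl, ← map_ι M (k + l) c (a + b)
    (by rw [Functor.map_add, Preadditive.add_comp, hk, hl]),
    Functor.map_add, Functor.map_add, Preadditive.add_comp]

instance (M : BanMod R) : (ihomFunctor M).Additive where
  map_add {V W f g} := ihom_hom_ext M fun A a => by
    rw [Preadditive.comp_add, ι_map, ι_map, ι_map, Preadditive.comp_add, ι_add]

end IndBan

/-! ### Strict exactness, the derived category and the left heart -/

section LeftHeart

universe v w

variable {E : Type w} [Category.{v} E] [Preadditive E] [HasKernels E] [HasCokernels E]

/-- A morphism is strict if the canonical morphism from its coimage to its image is invertible. -/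
def IsStrict {X Y : E} (f : X ⟶ Y) : Prop := IsIso (Abelian.coimageImageComparison f)

/-- A null sequence `X ⟶ Y ⟶ Z` is strictly exact if its first morphism is strict and the
canonical morphism from the image of the first morphism to the kernel of the second one is
invertible. -/
def IsStrictlyExact (S : ShortComplex E) : Prop :=
  IsStrict S.f ∧ IsIso (kernel.lift S.g (Abelian.image.ι S.f) (by
    rw [← cokernel.π_desc S.f S.g S.zero, kernel.condition_assoc, zero_comp]))

/-- Strict exactness of a cochain complex in degree `n`. -/
def StrictlyExactAt (X : CochainComplex E ℤ) (n : ℤ) : Prop := IsStrictlyExact (X.sc n)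

variable (E) [HasZeroObject E] [HasBinaryBiproducts E]

/-- The homotopy category of unbounded cochain complexes. -/
abbrev K := HomotopyCategory E (ComplexShape.up ℤ)

/-- The strictly exact complexes, as objects of the homotopy category. -/
def strictlyAcyclic : ObjectProperty (K E) := fun X => ∀ n, StrictlyExactAt X.as n

/-- The morphisms in the homotopy category whose cone is strictly exact. -/
abbrev strictQis : MorphismProperty (K E) := (strictlyAcyclic E).trW

/-- The derived category: the localisation of the homotopy category at the morphisms with strictly
exact cone. -/
abbrev D := (strictQis E).Localization

/-- The localisation functor. -/
abbrev Q : K E ⥤ D E := (strictQis E).Q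

/-- `D^{≤ 0}` of the left t-structure: complexes which are strictly exact in all degrees `> 0`. -/
def leftLE : ObjectProperty (D E) := fun X =>
  ∃ Y : K E, (∀ n > 0, StrictlyExactAt Y.as n) ∧ Nonempty ((Q E).obj Y ≅ X)

/-- `D^{≥ 0}` of the left t-structure: complexes which are strictly exact in all degrees `< 0`. -/
def leftGE : ObjectProperty (D E) := fun X =>
  ∃ Y : K E, (∀ n < 0, StrictlyExactAt Y.as n) ∧ Nonempty ((Q E).obj Y ≅ X)

/-- The left heart `LH(E)`: the heart `D^{≤ 0} ∩ D^{≥ 0}` of the left t-structure. -/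
abbrev LH := (leftLE E ⊓ leftGE E).FullSubcategory

/-- The inclusion of the left heart into the derived category. -/
abbrev LH.incl : LH E ⥤ D E := (leftLE E ⊓ leftGE E).ι

variable {E}

/-- `H` is the functor `LH⁰ ∘ G`, where `LH⁰ = τ^{≥ 0} τ^{≤ 0}` is the cohomology functor of the
left t-structure: there is a functor `Y` with values in `D^{≤ 0}`, a morphism `a : Y ⟶ G` which is
universal among morphisms from objects of `D^{≤ 0}` to the values of `G` (so `Y = τ^{≤ 0} G`), and
a morphism `b : Y ⟶ H` which is universal among morphisms from the values of `Y` to objects of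
`D^{≥ 0}` (so `H = τ^{≥ 0} Y`). -/
def IsLeftCohomologyZero {A : Type*} [Category* A] (G : A ⥤ D E) (H : A ⥤ LH E) : Prop :=
  ∃ (Y : A ⥤ D E) (a : Y ⟶ G) (b : Y ⟶ H ⋙ LH.incl E), ∀ V : A,
    leftLE E (Y.obj V) ∧
    (∀ X, leftLE E X → Function.Bijective fun f : X ⟶ Y.obj V => f ≫ a.app V) ∧
    (∀ X, leftGE E X → Function.Bijective fun f : (H ⋙ LH.incl E).obj V ⟶ X => b.app V ≫ f)

end LeftHeart

instance : HasBinaryBiproducts (IndBan R) := hasBinaryBiproducts_of_finite_biproducts _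

/-- The termwise internal hom functor `Hom(M, -)` on complexes of ind-Banach modules, up to
homotopy; here `M` is regarded as a complex concentrated in degree zero. -/
def ihomComplex (M : BanMod R) : K (IndBan R) ⥤ K (IndBan R) :=
  (IndBan.ihomFunctor M).mapHomotopyCategory (ComplexShape.up ℤ)

/-- `H` is the internal hom functor `Hom(I(M), -) = LH⁰(RHom(M, -))` on the left heart of the
category of ind-Banach modules: `RHom(M, -)` is the total right derived functor of the termwise
internal hom functor, and `H` is the cohomology in degree zero, with respect to the left
t-structure, of its restriction to the left heart. -/
def IsInternalHom (M : BanMod R) (H : LH (IndBan R) ⥤ LH (IndBan R)) : Prop :=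
  ∃ (RHom : D (IndBan R) ⥤ D (IndBan R))
    (α : ihomComplex M ⋙ Q (IndBan R) ⟶ Q (IndBan R) ⋙ RHom),
    RHom.IsRightDerivedFunctor α (strictQis (IndBan R)) ∧
    IsLeftCohomologyZero (LH.incl (IndBan R) ⋙ RHom) H

/-! ### The Tate algebra -/

section Tate

/-- The gauge `|π|^{m |α|}` of the monomial `X^α`, where `X = (X_1, …, X_d)`. -/
def gauge {F : Type u} [NontriviallyNormedField F] (π : F) (m d : ℕ) (α : Fin d →₀ ℕ) : ℝ :=
  ‖π‖ ^ (m * α.degree)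

lemma gauge_nonneg {F : Type u} [NontriviallyNormedField F] (π : F) (m d : ℕ) (α : Fin d →₀ ℕ) :
    0 ≤ gauge π m d α := pow_nonneg (norm_nonneg π) _

variable (F : Type u) [NontriviallyNormedField F] [IsUltrametricDist F]

/-- The valuation ring `F° = {x | ‖x‖ ≤ 1}`. -/
def integers : Subring F where
  carrier := {x | ‖x‖ ≤ 1}
  mul_mem' {a b} ha hb := by
    change ‖a * b‖ ≤ 1
    rw [norm_mul]
    exact mul_le_one₀ ha (norm_nonneg _) hb
  one_mem' := norm_one.le
  add_mem' {a b} ha hb := (IsUltrametricDist.norm_add_le_max a b).trans (max_le ha hb)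
  zero_mem' := by simp
  neg_mem' {a} ha := by
    change ‖-a‖ ≤ 1
    rwa [norm_neg]

variable {F} (π : F) (m d : ℕ)

/-- The underlying `F°`-module of `F°⟨X/π^m⟩`, where `X = (X_1, …, X_d)`: the power series
`∑_α a_α X^α = ∑_α (π^{m|α|} a_α) (X/π^m)^α` such that the coefficients `π^{m|α|} a_α` with respect
to the powers of `X/π^m` lie in `F°` and tend to zero. -/
def tateModule : Submodule (integers F) (MvPowerSeries (Fin d) F) where
  carrier := {a | (∀ α, ‖MvPowerSeries.coeff α a‖ * gauge π m d α ≤ 1) ∧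
    Tendsto (fun α => ‖MvPowerSeries.coeff α a‖ * gauge π m d α) cofinite (𝓝 0)}
  zero_mem' := by
    refine ⟨fun α => by simp, ?_⟩
    simp only [map_zero, norm_zero, zero_mul]
    exact tendsto_const_nhds
  add_mem' := by
    rintro a b ⟨ha, ha'⟩ ⟨hb, hb'⟩
    have h : ∀ α, ‖MvPowerSeries.coeff α (a + b)‖ * gauge π m d α ≤
        max (‖MvPowerSeries.coeff α a‖ * gauge π m d α)
          (‖MvPowerSeries.coeff α b‖ * gauge π m d α) := fun α => by
      rw [map_add, ← max_mul_of_nonneg _ _ (gauge_nonneg π m d α)]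
      exact mul_le_mul_of_nonneg_right (IsUltrametricDist.norm_add_le_max _ _)
        (gauge_nonneg π m d α)
    refine ⟨fun α => (h α).trans (max_le (ha α) (hb α)), ?_⟩
    refine squeeze_zero (fun α => mul_nonneg (norm_nonneg _) (gauge_nonneg π m d α)) h ?_
    simpa using ha'.max hb'
  smul_mem' := by
    rintro r a ⟨ha, ha'⟩
    have h : ∀ α, ‖MvPowerSeries.coeff α (r • a)‖ * gauge π m d α ≤
        ‖MvPowerSeries.coeff α a‖ * gauge π m d α := fun α => by
      refine mul_le_mul_of_nonneg_right ?_ (gauge_nonneg π m d α)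
      change ‖(r : F) * MvPowerSeries.coeff α a‖ ≤ _
      rw [norm_mul]
      exact mul_le_of_le_one_left (norm_nonneg _) r.2
    refine ⟨fun α => (h α).trans (ha α), ?_⟩
    exact squeeze_zero (fun α => mul_nonneg (norm_nonneg _) (gauge_nonneg π m d α)) h ha'

variable {π m d}

/-- The Gauss norm `‖∑_α f_α (X/π^m)^α‖ = sup_α |f_α|`. -/
def gaussNorm (a : tateModule π m d) : ℝ := ⨆ α, ‖MvPowerSeries.coeff α a.1‖ * gauge π m d α

lemma gaussNorm_le_iff (a : tateModule π m d) {c : ℝ} :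
    gaussNorm a ≤ c ↔ ∀ α, ‖MvPowerSeries.coeff α a.1‖ * gauge π m d α ≤ c := by
  refine ⟨fun h α => (le_ciSup (f := fun α => ‖MvPowerSeries.coeff α a.1‖ * gauge π m d α)
    ⟨1, ?_⟩ α).trans h, fun h => ciSup_le h⟩
  rintro _ ⟨α, rfl⟩
  exact a.2.1 α

lemma le_gaussNorm (a : tateModule π m d) (α : Fin d →₀ ℕ) :
    ‖MvPowerSeries.coeff α a.1‖ * gauge π m d α ≤ gaussNorm a :=
  (gaussNorm_le_iff a).1 le_rfl α

lemma gaussNorm_nonneg (a : tateModule π m d) : 0 ≤ gaussNorm a :=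
  (mul_nonneg (norm_nonneg _) (gauge_nonneg π m d 0)).trans (le_gaussNorm a 0)

lemma gaussNorm_add_le_max (a b : tateModule π m d) :
    gaussNorm (a + b) ≤ max (gaussNorm a) (gaussNorm b) := by
  refine (gaussNorm_le_iff _).2 fun α => ?_
  refine le_trans ?_ (max_le_max (le_gaussNorm a α) (le_gaussNorm b α))
  rw [← max_mul_of_nonneg _ _ (gauge_nonneg π m d α)]
  refine mul_le_mul_of_nonneg_right ?_ (gauge_nonneg π m d α)
  rw [Submodule.coe_add, map_add]
  exact IsUltrametricDist.norm_add_le_max _ _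

/-- The Gauss norm makes `F°⟨X/π^m⟩` a normed group. -/
abbrev tateNormed (hπ : π ≠ 0) (m d : ℕ) : NormedAddCommGroup (tateModule π m d) :=
  AddGroupNorm.toNormedAddCommGroup
    { toFun := gaussNorm
      map_zero' := le_antisymm ((gaussNorm_le_iff _).2 fun α => by simp) (gaussNorm_nonneg _)
      add_le' := fun a b => (gaussNorm_add_le_max a b).trans
        (max_le_add_of_nonneg (gaussNorm_nonneg a) (gaussNorm_nonneg b))
      neg' := fun a => by
        unfold gaussNorm
        congr 1
        ext x
        simp
      eq_zero_of_map_eq_zero' := fun a ha => by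
        ext α
        have h := le_gaussNorm a α
        have hg : 0 < gauge π m d α := pow_pos (norm_pos_iff.2 hπ) _
        change gaussNorm a = 0 at ha
        rw [ha] at h
        exact norm_le_zero_iff.1 (nonpos_of_mul_nonpos_left h hg) }

/-- The `F°`-Banach module `F°⟨X/π^m⟩`, where `X = (X_1, …, X_d)`. -/
def tate [CompleteSpace F] (hπ : π ≠ 0) (m d : ℕ) : BanMod (integers F) :=
  letI := tateNormed hπ m d
  { carrier := tateModule π m d
    ultrametric :=
      IsUltrametricDist.isUltrametricDist_of_forall_norm_add_le_max_norm gaussNorm_add_le_max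
    complete := by
      have hg : ∀ α, 0 < gauge π m d α := fun α => pow_pos (norm_pos_iff.2 hπ) _
      refine BanMod.completeSpace_of_eval (ι := Fin d →₀ ℕ) (W := fun _ => F)
        (fun α => { toFun := fun a => MvPowerSeries.coeff α a.1, map_zero' := rfl,
                    map_add' := fun _ _ => rfl })
        (fun α => (gauge π m d α)⁻¹) (fun a c hc => ?_) fun y hy => ?_
      · refine (gaussNorm_le_iff a).trans (forall_congr' fun α => ?_)
        rw [← div_eq_mul_inv, le_div_iff₀ (hg α)]
        rfl
      · change ∀ ε > 0, ∃ v : tateModule π m d, ∀ α,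
          ‖MvPowerSeries.coeff α v.1 - y α‖ ≤ ε * (gauge π m d α)⁻¹ at hy
        have hy' : ∀ ε > 0, ∃ v : tateModule π m d, ∀ α,
            ‖y α‖ * gauge π m d α ≤ max (‖MvPowerSeries.coeff α v.1‖ * gauge π m d α) ε := by
          intro ε hε
          obtain ⟨v, hv⟩ := hy ε hε
          refine ⟨v, fun α => ?_⟩
          have h1 := hv α
          rw [← div_eq_mul_inv, le_div_iff₀ (hg α)] at h1
          refine le_trans ?_ (max_le_max le_rfl h1)
          rw [← max_mul_of_nonneg _ _ (hg α).le]
          refine mul_le_mul_of_nonneg_right ?_ (hg α).le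
          have e : y α = MvPowerSeries.coeff α v.1 + -(MvPowerSeries.coeff α v.1 - y α) := by abel
          nth_rewrite 1 [e]
          rw [← norm_neg (MvPowerSeries.coeff α v.1 - y α)]
          exact IsUltrametricDist.norm_add_le_max _ _
        refine ⟨⟨y, fun α => ?_, ?_⟩, fun α => rfl⟩
        · obtain ⟨v, hv⟩ := hy' 1 one_pos
          exact (hv α).trans (max_le (v.2.1 α) le_rfl)
        · rw [Metric.tendsto_nhds]
          intro ε hε
          obtain ⟨v, hv⟩ := hy' (ε / 2) (half_pos hε)
          filter_upwards [(Metric.tendsto_nhds.1 v.2.2) ε hε] with α h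
          rw [Real.dist_0_eq_abs, abs_of_nonneg (mul_nonneg (norm_nonneg _) (hg α).le)] at h ⊢
          exact (hv α).trans_lt (max_lt h (half_lt_self hε))
    bounded_smul := by
      refine ⟨1, one_pos, fun r a => (gaussNorm_le_iff _).2 fun α => ?_⟩
      change ‖(r : F) * MvPowerSeries.coeff α a.1‖ * _ ≤ 1 * ‖(r : F)‖ * gaussNorm a
      rw [norm_mul, one_mul, mul_assoc]
      exact mul_le_mul_of_nonneg_left (le_gaussNorm a α) (norm_nonneg _) }

end Tate

end IndBanach

end

/-! After rescaling the monomials, F°⟨X/π^m⟩ becomes the Banach module c₀ of null families in F°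
indexed by ℕ^d. A bounded map out of c₀ is a bounded family of images of the standard generators.
Such a family lifts along a strict epimorphism with a loss of norm independent of the map, so
Hom(c₀, -) sends strict epimorphisms to strict epimorphisms for the operator norm
(`strictProjective_c0`, `strictProjective_tate`). Weighted versions of c₀ cover every Banach module
(`exists_strictProjective_cover`).

Banach modules are compact in the ind-category. Hence a sequence of ind-Banach modules is strictly
exact if and only if it is exact on generalised elements with strictly projective source P
(`isExactOn_of_isStrictlyExact`, `isStrictlyExact_of_isExactOn`). A chase with such elements shows
that Hom(M, -) preserves strict exactness when M is strictly projective
(`preservesStrictExactness_ihomFunctor`).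

The same generators control the derived category. Morphisms P[-n] ⟶ X up to homotopy form the n-th
cohomology of Hom(P, X). So the strictly exact complexes are the right orthogonal of the shifts
P[-n], localisation does not change morphisms out of P[-n], and the left t-structure is read off
from the vanishing of Hom(P[-n], X) in the derived category. Its heart is abelian, with short exact
sequences given by distinguished triangles.

As Hom(M, -) preserves strictly exact complexes, RHom(M, -) exists and is computed termwise; it is
triangulated and t-exact. On the heart LH⁰ therefore changes nothing, triangles in the heart go to
triangles in the heart, and the induced endofunctor is exact. -/

set_option linter.unusedSectionVars false

noncomputable section

namespace IndBanach

open Pretriangulated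

/-! ### Strict generators and the derived category -/

section Generators

universe v w

variable {E : Type w} [Category.{v} E] [Preadditive E] [HasKernels E] [HasCokernels E]

/-- A sequence `X ⟶ Y ⟶ Z` is exact on the generalised elements with source `P`. -/
def IsExactOn (P : E) (S : ShortComplex E) : Prop :=
  ∀ x : P ⟶ S.X₂, x ≫ S.g = 0 → ∃ y : P ⟶ S.X₁, y ≫ S.f = x

variable (E) in
/-- A class of objects whose generalised elements detect strict exactness. -/
class HasStrictGenerators where
  gen : ObjectProperty E
  isStrictlyExact_iff (S : ShortComplex E) : IsStrictlyExact S ↔ ∀ P, gen P → IsExactOn P S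

/-- The generators of a category with a class of strict generators. -/
abbrev gen [HasStrictGenerators E] : ObjectProperty E := HasStrictGenerators.gen

lemma isExactOn_sc_iff (P : E) (X : CochainComplex E ℤ) (i n j : ℤ) (hi : i + 1 = n)
    (hj : n + 1 = j) :
    IsExactOn P (X.sc n) ↔ ∀ x : P ⟶ X.X n, x ≫ X.d n j = 0 → ∃ y : P ⟶ X.X i, y ≫ X.d i n = x := by
  obtain rfl : i = (ComplexShape.up ℤ).prev n := by simp; lia
  obtain rfl : j = (ComplexShape.up ℤ).next n := by simp; lia
  rfl

variable [HasZeroObject E] [HasBinaryBiproducts E]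

/-- The complex `P` in degree `n`, as an object of the homotopy category. -/
abbrev single (n : ℤ) (P : E) : K E :=
  (HomotopyCategory.quotient E (.up ℤ)).obj ((CochainComplex.singleFunctor E n).obj P)

/-- The morphism from a complex concentrated in one degree given by a cocycle. -/
def fromSingle {P : E} {X : CochainComplex E ℤ} {n : ℤ} (j : ℤ) (hj : n + 1 = j) (x : P ⟶ X.X n)
    (hx : x ≫ X.d n j = 0) : single n P ⟶ (HomotopyCategory.quotient E (.up ℤ)).obj X :=
  (HomotopyCategory.quotient E (.up ℤ)).map
    ((CochainComplex.HomComplex.Cocycle.equivHom _ _).symm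
      (CochainComplex.HomComplex.Cocycle.fromSingleMk x (add_zero n) j hj hx))

open CochainComplex.HomComplex in
lemma fromSingle_surjective {P : E} {X : CochainComplex E ℤ} {n : ℤ} (j : ℤ) (hj : n + 1 = j)
    (f : single n P ⟶ (HomotopyCategory.quotient E (.up ℤ)).obj X) :
    ∃ (x : P ⟶ X.X n) (hx : x ≫ X.d n j = 0), fromSingle j hj x hx = f := by
  obtain ⟨f, rfl⟩ := (HomotopyCategory.quotient E (.up ℤ)).map_surjective
    (X := (CochainComplex.singleFunctor E n).obj P) f
  obtain ⟨x, hx, h⟩ := Cocycle.fromSingleMk_surjective (Cocycle.equivHom _ _ f) n (add_zero n) j hj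
  refine ⟨x, hx, ?_⟩
  rw [fromSingle, h, AddEquiv.symm_apply_apply]

open CochainComplex.HomComplex in
-- A null-homotopy of a map out of a complex concentrated in degree `n` has a single component, `P ⟶
-- X.X (n - 1)`.
lemma fromSingle_eq_zero_iff {P : E} {X : CochainComplex E ℤ} {n : ℤ} (i j : ℤ) (hi : i + 1 = n)
    (hj : n + 1 = j) (x : P ⟶ X.X n) (hx : x ≫ X.d n j = 0) :
    fromSingle j hj x hx = 0 ↔ ∃ y : P ⟶ X.X i, y ≫ X.d i n = x := by
  rw [← Cocycle.fromSingleMk_mem_coboundaries_iff x (add_zero n) j hj hx i hi,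
    mem_coboundaries_iff _ (-1) (by simp)]
  constructor
  · intro h
    have ho := HomotopyCategory.homotopyOfEq _ _ (h.trans (Functor.map_zero _ _ _).symm)
    refine ⟨(Cochain.equivHomotopy _ _ ho).1, ?_⟩
    have h2 := (Cochain.equivHomotopy _ _ ho).2
    simp only [Cochain.ofHom_zero, add_zero] at h2
    rw [← h2]
    simp
  · rintro ⟨z, hz⟩
    rw [fromSingle, ← (HomotopyCategory.quotient E (.up ℤ)).map_zero]
    refine HomotopyCategory.eq_of_homotopy _ _ ((Cochain.equivHomotopy _ _).symm ⟨z, ?_⟩)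
    simp [hz]

lemma fromSingle_comp {P : E} {X Y : CochainComplex E ℤ} {n : ℤ} (j : ℤ) (hj : n + 1 = j)
    (x : P ⟶ X.X n) (hx : x ≫ X.d n j = 0) (f : X ⟶ Y) :
    fromSingle j hj x hx ≫ (HomotopyCategory.quotient E (.up ℤ)).map f =
      fromSingle j hj (x ≫ f.f n) (by rw [Category.assoc, f.comm, reassoc_of% hx, zero_comp]) := by
  rw [fromSingle, fromSingle, ← Functor.map_comp]
  congr 1
  apply (CochainComplex.HomComplex.Cocycle.equivHom _ _).injective
  rw [CochainComplex.HomComplex.Cocycle.fromSingleMk_postcomp x (add_zero n) j hj hx]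
  ext : 1
  simp

/-- Homotopy classes of maps out of `single n P` are cocycles modulo coboundaries, that is, the
`n`-th cohomology of Hom(P, X). -/
lemma isExactOn_sc_iff_forall_eq_zero (P : E) (X : CochainComplex E ℤ) (n : ℤ) :
    IsExactOn P (X.sc n) ↔
      ∀ f : single n P ⟶ (HomotopyCategory.quotient E (.up ℤ)).obj X, f = 0 := by
  rw [isExactOn_sc_iff P X (n - 1) n (n + 1) (by simp) rfl]
  constructor
  · intro h f
    obtain ⟨x, hx, rfl⟩ := fromSingle_surjective (n + 1) rfl f
    rw [fromSingle_eq_zero_iff (n - 1) _ (by simp)]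
    exact h x hx
  · intro h x hx
    rw [← fromSingle_eq_zero_iff (n - 1) (n + 1) (by simp) rfl x hx]
    exact h _

variable [HasStrictGenerators E]

lemma strictlyExactAt_iff (X : K E) (n : ℤ) :
    StrictlyExactAt X.as n ↔ ∀ P, gen P → ∀ f : single n P ⟶ X, f = 0 := by
  refine (HasStrictGenerators.isStrictlyExact_iff _).trans ?_
  exact forall₂_congr fun P _ => isExactOn_sc_iff_forall_eq_zero P X.as n

variable (E) in
/-- The shifts of the generators, as objects of the homotopy category. -/
def shiftedGen : ObjectProperty (K E) := fun X => ∃ (P : E) (n : ℤ), gen P ∧ Nonempty (X ≅ single n P)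

/-- The shift of a complex concentrated in one degree. -/
def singleShiftIso (a n n' : ℤ) (h : a + n = n') (P : E) : (single n' P)⟦a⟧ ≅ single n P :=
  ((HomotopyCategory.singleFunctors E).shiftIso a n n' h).app P

instance : (shiftedGen E).IsStableUnderShift ℤ where
  isStableUnderShiftBy a := ⟨by
    rintro X ⟨P, n, hP, ⟨e⟩⟩
    exact ⟨P, n - a, hP, ⟨(shiftFunctor _ a).mapIso e ≪≫ singleShiftIso a (n - a) n (by simp) P⟩⟩⟩

/-- The right orthogonal of a shift-stable class is a triangulated subcategory. This makes the
derived category a Verdier quotient, hence triangulated. -/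
lemma strictlyAcyclic_eq : strictlyAcyclic E = (shiftedGen E).rightOrthogonal := by
  ext X
  constructor
  · rintro h Y f ⟨P, n, hP, ⟨e⟩⟩
    rw [← cancel_epi e.inv, comp_zero]
    exact (strictlyExactAt_iff X n).1 (h n) P hP _
  · intro h n
    exact (strictlyExactAt_iff X n).2 fun P hP f => h f ⟨P, n, hP, ⟨Iso.refl _⟩⟩

instance : (strictlyAcyclic E).IsTriangulated := by
  rw [strictlyAcyclic_eq]
  infer_instance

lemma single_leftOrthogonal (n : ℤ) {P : E} (hP : gen P) :
    (strictlyAcyclic E).leftOrthogonal (single n P) := fun X f hX =>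
  (strictlyExactAt_iff X n).1 (hX n) P hP f

/-- There are no nonzero maps from a shifted generator to a strictly exact complex, so inverting
maps with strictly exact cone neither adds nor kills maps out of it. -/
lemma Q_map_single_bijective (n : ℤ) {P : E} (hP : gen P) (X : K E) :
    Function.Bijective ((Q E).map : (single n P ⟶ X) → _) :=
  ObjectProperty.leftOrthogonal.map_bijective_of_isTriangulated (single_leftOrthogonal n hP) _ _

/-- The cohomology of an object of the derived category vanishes in degree `n`. -/
def VanishesAt (n : ℤ) (X : D E) : Prop :=
  ∀ P, gen P → ∀ f : (Q E).obj (single n P) ⟶ X, f = 0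

/-- Strict exactness in one degree thus depends only on the image of the complex in the derived
category. -/
lemma vanishesAt_Q_iff (n : ℤ) (X : K E) : VanishesAt n ((Q E).obj X) ↔ StrictlyExactAt X.as n := by
  rw [strictlyExactAt_iff]
  refine forall₂_congr fun P hP => ?_
  rw [(Q_map_single_bijective n hP X).2.forall]
  refine forall_congr' fun f => ?_
  rw [← (Q_map_single_bijective n hP X).1.eq_iff, Functor.map_zero]

lemma VanishesAt.of_iso {n : ℤ} {X Y : D E} (e : X ≅ Y) (h : VanishesAt n X) : VanishesAt n Y :=
  fun P hP f => by rw [← cancel_mono e.inv, zero_comp]; exact h P hP _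

lemma VanishesAt.shift {n : ℤ} {X : D E} (h : VanishesAt n X) (a n' : ℤ) (hn' : a + n' = n) :
    VanishesAt n' (X⟦a⟧) := fun P hP f => by
  let e : (Q E).obj (single n' P) ≅ ((Q E).obj (single n P))⟦a⟧ :=
    (Q E).mapIso (singleShiftIso a n' n hn' P).symm ≪≫ ((Q E).commShiftIso a).app _
  obtain ⟨g, hg⟩ := (shiftFunctor (D E) a).map_surjective (e.inv ≫ f)
  rw [← cancel_epi e.inv, ← hg, h P hP g, Functor.map_zero, comp_zero]

lemma VanishesAt.obj₂ {n : ℤ} {T : Triangle (D E)}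
    (hT : T ∈ distTriang (D E)) (h₁ : VanishesAt n T.obj₁)
    (h₃ : VanishesAt n T.obj₃) : VanishesAt n T.obj₂ := fun P hP f => by
  obtain ⟨g, rfl⟩ := Triangle.coyoneda_exact₂ T hT f (h₃ P hP _)
  rw [h₁ P hP g, zero_comp]

/-- This lemma and the next read off the long exact sequence of Hom(P[-n], -), by rotating the
triangle. -/
lemma VanishesAt.obj₃ {n n' : ℤ} (hn : n + 1 = n') {T : Triangle (D E)}
    (hT : T ∈ distTriang (D E)) (h₂ : VanishesAt n T.obj₂)
    (h₁ : VanishesAt n' T.obj₁) : VanishesAt n T.obj₃ :=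
  VanishesAt.obj₂ (rot_of_distTriang T hT) h₂ (h₁.shift 1 n (by lia))

lemma VanishesAt.obj₁ {n n' : ℤ} (hn : n' + 1 = n) {T : Triangle (D E)}
    (hT : T ∈ distTriang (D E)) (h₂ : VanishesAt n T.obj₂)
    (h₃ : VanishesAt n' T.obj₃) : VanishesAt n T.obj₁ :=
  VanishesAt.obj₂ (inv_rot_of_distTriang T hT) (h₃.shift (-1) n (by lia)) h₂

lemma isZero_of_forall_vanishesAt {X : D E} (h : ∀ n, VanishesAt n X) : IsZero X := by
  have := Localization.essSurj (Q E) (strictQis E)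
  let e := (Q E).objObjPreimageIso X
  have hK : strictlyAcyclic E ((Q E).objPreimage X) := fun n =>
    (vanishesAt_Q_iff n _).1 ((h n).of_iso e.symm)
  -- The morphism from 0 to a complex has that complex as its cone; if the cone is strictly exact,
  -- the morphism becomes invertible.
  have hz := ObjectProperty.trW.mk (strictlyAcyclic E) (contractible_distinguished₁ _) hK
  have hi := Localization.inverts (Q E) (strictQis E) _ hz
  refine IsZero.of_iso ((Q E).map_isZero (isZero_zero _)) (e.symm ≪≫ (@asIso _ _ _ _ _ hi).symm)

end Generators

/-! ### Truncation and the left t-structure -/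

lemma distinguished_of_iso₂ {C : Type*} [Category* C] [Preadditive C] [HasZeroObject C]
    [HasShift C ℤ] [∀ n : ℤ, (shiftFunctor C n).Additive] [Pretriangulated C] {X Y Z A : C}
    {f : X ⟶ Y} {g : Y ⟶ Z} {h : Z ⟶ X⟦(1 : ℤ)⟧} (hT : Triangle.mk f g h ∈ distTriang C)
    (e : Y ≅ A) : Triangle.mk (f ≫ e.hom) (e.inv ≫ g) h ∈ distTriang C :=
  isomorphic_distinguished _ hT _ (Triangle.isoMk _ _ (Iso.refl _) e.symm (Iso.refl _)
    (by change (f ≫ e.hom) ≫ e.inv = 𝟙 X ≫ f; simp)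
    (by change (e.inv ≫ g) ≫ 𝟙 Z = e.inv ≫ g; simp)
    (by change h ≫ (𝟙 X)⟦(1 : ℤ)⟧' = 𝟙 Z ≫ h; simp))

section Truncation

universe v w

variable {E : Type w} [Category.{v} E] [Preadditive E] [HasKernels E] [HasCokernels E]
  [HasZeroObject E] [HasBinaryBiproducts E]

/-- A morphism whose kernel is the degree `n` term of the truncation `τ^{≤ 0}`. -/
def truncAux (A : CochainComplex E ℤ) (n : ℤ) : A.X n ⟶ A.X n ⊞ A.X (n + 1) :=
  biprod.lift (if 0 < n then 𝟙 _ else 0) (if 0 ≤ n then A.d n (n + 1) else 0)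

/-- The kernel of `truncAux A n` is everything for `n < 0`, the cocycles for `n = 0` and zero for `n
> 0`. Writing all three as one kernel avoids a case distinction in the terms of the truncated
complex. -/
lemma comp_truncAux_eq_zero_iff {A : CochainComplex E ℤ} {n : ℤ} {W : E} (x : W ⟶ A.X n) :
    x ≫ truncAux A n = 0 ↔ (0 < n → x = 0) ∧ (0 ≤ n → ∀ j, x ≫ A.d n j = 0) := by
  rw [truncAux, biprod.hom_ext_iff]
  simp only [Category.assoc, biprod.lift_fst, biprod.lift_snd, zero_comp]
  refine and_congr ?_ ?_
  · split_ifs with h <;> simp [h]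
  · split_ifs with h
    · simp only [h, true_imp_iff]
      refine ⟨fun h' j => ?_, fun h' => h' _⟩
      by_cases hj : n + 1 = j
      · subst hj
        exact h'
      · rw [A.shape _ _ (by simpa using hj), comp_zero]
    · simp [h]

lemma kernel_truncAux (A : CochainComplex E ℤ) (n : ℤ) :
    (0 < n → kernel.ι (truncAux A n) = 0) ∧
      (0 ≤ n → ∀ j, kernel.ι (truncAux A n) ≫ A.d n j = 0) :=
  (comp_truncAux_eq_zero_iff _).1 (kernel.condition _)

lemma trunc_d_aux (A : CochainComplex E ℤ) (i j : ℤ) :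
    (kernel.ι (truncAux A i) ≫ A.d i j) ≫ truncAux A j = 0 := by
  by_cases hij : i + 1 = j
  · rw [comp_truncAux_eq_zero_iff]
    exact ⟨fun h => (kernel_truncAux A i).2 (by lia) j, fun _ k => by simp⟩
  · rw [A.shape _ _ (by simpa using hij), comp_zero, zero_comp]

/-- The truncation `τ^{≤ 0}` of the left t-structure: `⋯ ⟶ A⁻¹ ⟶ ker d⁰ ⟶ 0 ⟶ ⋯`. -/
def trunc (A : CochainComplex E ℤ) : CochainComplex E ℤ where
  X n := kernel (truncAux A n)
  d i j := kernel.lift _ (kernel.ι (truncAux A i) ≫ A.d i j) (trunc_d_aux A i j)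
  shape i j h := by
    rw [← cancel_mono (kernel.ι _), kernel.lift_ι, A.shape i j h, comp_zero, zero_comp]
  d_comp_d' i j k _ _ := by
    rw [← cancel_mono (kernel.ι _)]
    simp

/-- The inclusion of the truncation. -/
def truncι (A : CochainComplex E ℤ) : trunc A ⟶ A where
  f n := kernel.ι (truncAux A n)
  comm' i j _ := by simp [trunc]

instance (A : CochainComplex E ℤ) (n : ℤ) : Mono ((truncι A).f n) :=
  inferInstanceAs (Mono (kernel.ι _))

lemma exists_lift_truncι_f (A : CochainComplex E ℤ) {n : ℤ} {W : E} (x : W ⟶ A.X n)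
    (h : 0 < n → x = 0) (h' : 0 ≤ n → ∀ j, x ≫ A.d n j = 0) :
    ∃ y : W ⟶ (trunc A).X n, y ≫ (truncι A).f n = x :=
  ⟨kernel.lift _ x ((comp_truncAux_eq_zero_iff x).2 ⟨h, h'⟩), kernel.lift_ι _ _ _⟩

lemma isZero_trunc_X (A : CochainComplex E ℤ) {n : ℤ} (hn : 0 < n) : IsZero ((trunc A).X n) := by
  rw [IsZero.iff_id_eq_zero, ← cancel_mono ((truncι A).f n)]
  rw [show (truncι A).f n = 0 from (kernel_truncAux A n).1 hn, comp_zero, comp_zero]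

lemma exists_lift_truncι {Z A : CochainComplex E ℤ} (f : Z ⟶ A)
    (hZ : ∀ n : ℤ, 0 < n → IsZero (Z.X n)) : ∃ g : Z ⟶ trunc A, g ≫ truncι A = f := by
  choose g hg using fun n => exists_lift_truncι_f A (f.f n) (fun h => (hZ n h).eq_of_src _ _)
    (fun h j => by
      rw [f.comm]
      by_cases hj : n + 1 = j
      · rw [(hZ j (by lia)).eq_of_tgt (Z.d n j) 0, zero_comp]
      · rw [Z.shape _ _ (by simpa using hj), zero_comp])
  refine ⟨⟨g, fun i j _ => ?_⟩, by ext n; exact hg n⟩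
  rw [← cancel_mono ((truncι A).f j), Category.assoc, Category.assoc, hg, ← (truncι A).comm,
    reassoc_of% hg, f.comm]

/-- With the next lemma, this says that the inclusion of the truncation is bijective on cohomology
in degrees `≤ 0`; injectivity holds in every degree. -/
lemma exists_lift_single_truncι (A : CochainComplex E ℤ) {n : ℤ} (hn : n ≤ 0) (P : E)
    (f : single n P ⟶ (HomotopyCategory.quotient E (.up ℤ)).obj A) :
    ∃ g : single n P ⟶ (HomotopyCategory.quotient E (.up ℤ)).obj (trunc A),
      g ≫ (HomotopyCategory.quotient E (.up ℤ)).map (truncι A) = f := by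
  obtain ⟨x, hx, rfl⟩ := fromSingle_surjective (n + 1) rfl f
  obtain ⟨y, rfl⟩ := exists_lift_truncι_f A x (fun h => by lia) (fun _ j => by
    by_cases hj : n + 1 = j
    · subst hj
      exact hx
    · rw [A.shape _ _ (by simpa using hj), comp_zero])
  refine ⟨fromSingle (n + 1) rfl y ?_, fromSingle_comp _ _ _ _ _⟩
  rw [← cancel_mono ((truncι A).f _), Category.assoc, ← (truncι A).comm, zero_comp, ← hx,
    Category.assoc]

lemma single_trunc_eq_zero (A : CochainComplex E ℤ) {n : ℤ} (P : E)
    (f : single n P ⟶ (HomotopyCategory.quotient E (.up ℤ)).obj (trunc A))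
    (hf : f ≫ (HomotopyCategory.quotient E (.up ℤ)).map (truncι A) = 0) : f = 0 := by
  obtain ⟨x, hx, rfl⟩ := fromSingle_surjective (n + 1) rfl f
  rw [fromSingle_eq_zero_iff (n - 1) (n + 1) (by simp) rfl]
  by_cases hn : 0 < n
  · exact ⟨0, (isZero_trunc_X A hn).eq_of_tgt _ _⟩
  rw [fromSingle_comp, fromSingle_eq_zero_iff (n - 1) (n + 1) (by simp) rfl] at hf
  obtain ⟨y, hy⟩ := hf
  -- The element `y` lies in degree `n - 1 < 0`, where truncation changes nothing.
  obtain ⟨z, rfl⟩ := exists_lift_truncι_f A y (fun h => by lia) (fun h => by lia)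
  refine ⟨z, ?_⟩
  rw [← cancel_mono ((truncι A).f _), ← hy, Category.assoc, Category.assoc, (truncι A).comm]

variable [HasStrictGenerators E]

lemma strictlyExactAt_of_isZero {X : CochainComplex E ℤ} {n : ℤ} (h : IsZero (X.X n)) :
    StrictlyExactAt X n :=
  (HasStrictGenerators.isStrictlyExact_iff _).2 fun _ _ _ _ => ⟨0, h.eq_of_tgt _ _⟩

lemma strictlyExactAt_trunc (A : CochainComplex E ℤ) {n : ℤ} (h : 0 < n ∨ StrictlyExactAt A n) :
    StrictlyExactAt (trunc A) n := by
  obtain h | h := h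
  · exact strictlyExactAt_of_isZero (isZero_trunc_X A h)
  · exact (strictlyExactAt_iff ((HomotopyCategory.quotient E (.up ℤ)).obj (trunc A)) n).2
      fun P hP f => single_trunc_eq_zero A P f
        ((strictlyExactAt_iff ((HomotopyCategory.quotient E (.up ℤ)).obj A) n).1 h P hP _)

/-- In the long exact sequence, the cohomology of the cone in degree `n ≤ 0` sits between a
surjection in degree `n` and an injection in degree `n + 1`. -/
lemma strictlyExactAt_cone_truncι (A : CochainComplex E ℤ) {C : K E}
    (g : (HomotopyCategory.quotient E (.up ℤ)).obj A ⟶ C)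
    (h : C ⟶ ((HomotopyCategory.quotient E (.up ℤ)).obj (trunc A))⟦(1 : ℤ)⟧)
    (hT : Triangle.mk ((HomotopyCategory.quotient E (.up ℤ)).map (truncι A)) g h ∈ distTriang (K E))
    {n : ℤ} (hn : n ≤ 0) : StrictlyExactAt C.as n := by
  refine (strictlyExactAt_iff _ n).2 fun P hP f => ?_
  let e := singleShiftIso 1 n (n + 1) (by lia) P
  have hfh : f ≫ h = 0 := by
    -- Desuspended, the boundary of `f` is a class of degree `n + 1` in the truncation that dies in
    -- `A`; injectivity is also needed at `n + 1 = 1`.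
    obtain ⟨k, hk⟩ := (shiftFunctor (K E) (1 : ℤ)).map_surjective (e.hom ≫ f ≫ h)
    have hk0 : k = 0 := by
      apply single_trunc_eq_zero
      apply (shiftFunctor (K E) (1 : ℤ)).map_injective
      have h31 : h ≫ ((HomotopyCategory.quotient E (.up ℤ)).map (truncι A))⟦(1 : ℤ)⟧' = 0 :=
        comp_distTriang_mor_zero₃₁ _ hT
      rw [Functor.map_comp, hk, Category.assoc, Category.assoc, h31, comp_zero, comp_zero,
        Functor.map_zero]
    rw [← cancel_epi e.hom, ← hk, hk0, Functor.map_zero, comp_zero]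
  obtain ⟨k, rfl⟩ := Triangle.coyoneda_exact₃ _ hT f hfh
  obtain ⟨l, rfl⟩ := exists_lift_single_truncι A hn P k
  have h12 : (HomotopyCategory.quotient E (.up ℤ)).map (truncι A) ≫ g = 0 :=
    comp_distTriang_mor_zero₁₂ _ hT
  change (l ≫ _) ≫ g = 0
  rw [Category.assoc, h12, comp_zero]

/-- The objects of the derived category represented by complexes which are strictly exact in all
degrees `> n`. -/
def leftLEAt (n : ℤ) : ObjectProperty (D E) := fun X =>
  ∃ Y : K E, (∀ k > n, StrictlyExactAt Y.as k) ∧ Nonempty ((Q E).obj Y ≅ X)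

/-- The objects of the derived category represented by complexes which are strictly exact in all
degrees `< n`. -/
def leftGEAt (n : ℤ) : ObjectProperty (D E) := fun X =>
  ∃ Y : K E, (∀ k < n, StrictlyExactAt Y.as k) ∧ Nonempty ((Q E).obj Y ≅ X)

/-- The aisles are defined by the existence of a representative; this makes membership a vanishing
condition that any representative satisfies. -/
lemma exists_representative (X : D E) (p : ℤ → Prop) :
    (∃ Y : K E, (∀ k, p k → StrictlyExactAt Y.as k) ∧ Nonempty ((Q E).obj Y ≅ X)) ↔
      ∀ k, p k → VanishesAt k X := by
  constructor
  · rintro ⟨Y, hY, ⟨e⟩⟩ k hk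
    exact ((vanishesAt_Q_iff k Y).2 (hY k hk)).of_iso e
  · intro h
    have := Localization.essSurj (Q E) (strictQis E)
    exact ⟨(Q E).objPreimage X, fun k hk => (vanishesAt_Q_iff k _).1
      ((h k hk).of_iso ((Q E).objObjPreimageIso X).symm), ⟨(Q E).objObjPreimageIso X⟩⟩

lemma leftLEAt_iff {n : ℤ} {X : D E} : leftLEAt n X ↔ ∀ k, n < k → VanishesAt k X :=
  exists_representative X (fun k => n < k)

lemma leftGEAt_iff {n : ℤ} {X : D E} : leftGEAt n X ↔ ∀ k, k < n → VanishesAt k X :=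
  exists_representative X (fun k => k < n)

instance (n : ℤ) : (leftLEAt (E := E) n).IsClosedUnderIsomorphisms where
  of_iso := by
    rintro X Y e ⟨Z, hZ, ⟨e'⟩⟩
    exact ⟨Z, hZ, ⟨e' ≪≫ e⟩⟩

instance (n : ℤ) : (leftGEAt (E := E) n).IsClosedUnderIsomorphisms where
  of_iso := by
    rintro X Y e ⟨Z, hZ, ⟨e'⟩⟩
    exact ⟨Z, hZ, ⟨e' ≪≫ e⟩⟩

lemma exists_trunc_triangle (X : CochainComplex E ℤ) :
    ∃ (Y : D E) (g : (Q E).obj ((HomotopyCategory.quotient E (.up ℤ)).obj X) ⟶ Y)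
      (h : Y ⟶ ((Q E).obj ((HomotopyCategory.quotient E (.up ℤ)).obj (trunc X)))⟦(1 : ℤ)⟧),
      leftGEAt 1 Y ∧ Triangle.mk ((Q E).map ((HomotopyCategory.quotient E (.up ℤ)).map (truncι X)))
        g h ∈ distTriang (D E) := by
  obtain ⟨C, g, h, hT⟩ := distinguished_cocone_triangle
    ((HomotopyCategory.quotient E (.up ℤ)).map (truncι X))
  exact ⟨_, _, _, ⟨C, fun k hk => strictlyExactAt_cone_truncι X g h hT (by lia), ⟨Iso.refl _⟩⟩,
    (Q E).map_distinguished _ hT⟩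

lemma leftLEAt_trunc (X : CochainComplex E ℤ) :
    leftLEAt 0 ((Q E).obj ((HomotopyCategory.quotient E (.up ℤ)).obj (trunc X))) :=
  ⟨_, fun _ hk => strictlyExactAt_trunc X (Or.inl hk), ⟨Iso.refl _⟩⟩

lemma isIso_Q_map_truncι {X : CochainComplex E ℤ} (h : ∀ k > 0, StrictlyExactAt X k) :
    IsIso ((Q E).map ((HomotopyCategory.quotient E (.up ℤ)).map (truncι X))) := by
  obtain ⟨Y, g, h', hY, hT⟩ := exists_trunc_triangle X
  refine (Triangle.isZero₃_iff_isIso₁ _ hT).1 (isZero_of_forall_vanishesAt fun n => ?_)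
  by_cases hn : n < 1
  · exact leftGEAt_iff.1 hY n hn
  · exact VanishesAt.obj₃ rfl hT
      ((vanishesAt_Q_iff n ((HomotopyCategory.quotient E (.up ℤ)).obj X)).2 (h n (by lia)))
      (leftLEAt_iff.1 (leftLEAt_trunc X) _ (by lia))

/-- The source may be replaced by its truncation, which lives in degrees `≤ 0`. The numerator of a
left fraction then factors through the truncation of a complex strictly exact in degrees `≤ 0`, and
that truncation is strictly exact everywhere. -/
lemma eq_zero_of_leftLEAt_of_leftGEAt {X Y : D E} (f : X ⟶ Y) (hX : leftLEAt 0 X)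
    (hY : leftGEAt 1 Y) : f = 0 := by
  obtain ⟨X', hX', ⟨e⟩⟩ := hX
  obtain ⟨Y', hY', ⟨e'⟩⟩ := id hY
  obtain ⟨X', rfl⟩ := HomotopyCategory.quotient_obj_surjective X'
  have := isIso_Q_map_truncι (X := X') hX'
  rw [← cancel_epi e.hom,
    ← cancel_epi ((Q E).map ((HomotopyCategory.quotient E (.up ℤ)).map (truncι X'))),
    ← cancel_mono e'.inv]
  simp only [comp_zero, zero_comp]
  generalize (_ ≫ _) ≫ e'.inv = φ
  obtain ⟨ψ, rfl⟩ := Localization.exists_leftFraction (Q E) (strictQis E) φ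
  have hi := Localization.inverts (Q E) (strictQis E) _ ψ.hs
  have hZ : ∀ k < 1, StrictlyExactAt ψ.Y'.as k := fun k hk => by
    rw [← vanishesAt_Q_iff]
    exact (leftGEAt_iff.1 hY k hk).of_iso (e'.symm ≪≫ @asIso _ _ _ _ _ hi)
  suffices (Q E).map ψ.f = 0 by
    rw [← cancel_mono ((Q E).map ψ.s), MorphismProperty.LeftFraction.map_comp_map_s, this, zero_comp]
  obtain ⟨g, hg⟩ := (HomotopyCategory.quotient E (.up ℤ)).map_surjective
    (X := trunc X') (Y := ψ.Y'.as) ψ.f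
  obtain ⟨l, rfl⟩ := exists_lift_truncι g (fun n hn => isZero_trunc_X X' hn)
  have hz : IsZero ((Q E).obj ((HomotopyCategory.quotient E (.up ℤ)).obj (trunc ψ.Y'.as))) :=
    isZero_of_forall_vanishesAt fun n => (vanishesAt_Q_iff n _).2
      (strictlyExactAt_trunc _ (by
        by_cases hn : 0 < n
        · exact Or.inl hn
        · exact Or.inr (hZ n (by lia))))
  rw [← hg, Functor.map_comp]
  exact ((Q E).map_comp _ _).trans ((congrArg (_ ≫ ·) (hz.eq_of_src _ 0)).trans comp_zero)

variable (E) in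
/-- The left t-structure on the derived category. -/
def leftTStructure : Triangulated.TStructure (D E) where
  le := leftLEAt
  ge := leftGEAt
  le_shift n a n' h X hX := leftLEAt_iff.2 fun k hk =>
    (leftLEAt_iff.1 hX (a + k) (by lia)).shift a k rfl
  ge_shift n a n' h X hX := leftGEAt_iff.2 fun k hk =>
    (leftGEAt_iff.1 hX (a + k) (by lia)).shift a k rfl
  zero' _ _ f hX hY := eq_zero_of_leftLEAt_of_leftGEAt f hX hY
  le_zero_le X hX := leftLEAt_iff.2 fun k hk => leftLEAt_iff.1 hX k (by lia)
  ge_one_le X hX := leftGEAt_iff.2 fun k hk => leftGEAt_iff.1 hX k (by lia)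
  exists_triangle_zero_one A := by
    have := Localization.essSurj (Q E) (strictQis E)
    obtain ⟨B, ⟨e⟩⟩ : ∃ B : CochainComplex E ℤ,
        Nonempty ((Q E).obj ((HomotopyCategory.quotient E (.up ℤ)).obj B) ≅ A) :=
      ⟨((Q E).objPreimage A).as, ⟨(Q E).objObjPreimageIso A⟩⟩
    obtain ⟨Y, g, h, hY, hT⟩ := exists_trunc_triangle B
    exact ⟨_, Y, leftLEAt_trunc _, hY, _, _, h, distinguished_of_iso₂ hT e⟩

end Truncation

/-! ### The left heart is abelian -/

open Triangulated

lemma distinguished_of_iso₁ {C : Type*} [Category* C] [Preadditive C] [HasZeroObject C]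
    [HasShift C ℤ] [∀ n : ℤ, (shiftFunctor C n).Additive] [Pretriangulated C] {X Y Z A : C}
    {f : X ⟶ Y} {g : Y ⟶ Z} {h : Z ⟶ X⟦(1 : ℤ)⟧} (hT : Triangle.mk f g h ∈ distTriang C)
    (e : X ≅ A) : Triangle.mk (e.inv ≫ f) g (h ≫ e.hom⟦(1 : ℤ)⟧') ∈ distTriang C :=
  isomorphic_distinguished _ hT _ (Triangle.isoMk _ _ e.symm (Iso.refl _) (Iso.refl _)
    (by change (e.inv ≫ f) ≫ 𝟙 Y = e.inv ≫ f; simp)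
    (by change g ≫ 𝟙 Z = 𝟙 Y ≫ g; simp)
    (by
      change (h ≫ e.hom⟦(1 : ℤ)⟧') ≫ e.inv⟦(1 : ℤ)⟧' = 𝟙 Z ≫ h
      rw [Category.assoc, ← Functor.map_comp, e.hom_inv_id, CategoryTheory.Functor.map_id,
        Category.comp_id, Category.id_comp]))

section Heart

universe v w

variable {E : Type w} [Category.{v} E] [Preadditive E] [HasKernels E] [HasCokernels E]
  [HasZeroObject E] [HasBinaryBiproducts E] [HasStrictGenerators E]

lemma VanishesAt.of_isLimit {n : ℤ} {J : Type*} [Category* J] {F : J ⥤ D E} {c : Cone F}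
    (hc : IsLimit c) (h : ∀ j, VanishesAt n (F.obj j)) : VanishesAt n c.pt := fun P hP _ =>
  hc.hom_ext fun j => (h j P hP _).trans zero_comp.symm

instance (J : Type*) [Category* J] : (leftLE E ⊓ leftGE E).IsClosedUnderLimitsOfShape J where
  limitsOfShape_le := by
    rintro X ⟨p⟩
    exact ⟨leftLEAt_iff.2 fun k hk => VanishesAt.of_isLimit p.isLimit fun j =>
        leftLEAt_iff.1 (p.prop_diag_obj j).1 k hk,
      leftGEAt_iff.2 fun k hk => VanishesAt.of_isLimit p.isLimit fun j =>
        leftGEAt_iff.1 (p.prop_diag_obj j).2 k hk⟩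

instance : HasFiniteProducts (LH E) := ⟨fun _ => inferInstance⟩

lemma heart_hom_shift_eq_zero ⦃X Y : LH E⦄ ⦃n : ℤ⦄
    (f : (LH.incl E).obj X ⟶ ((LH.incl E).obj Y)⟦n⟧) (hn : n < 0) : f = 0 :=
  (leftTStructure E).zero_of_isLE_of_isGE f 0 (-n) (by lia) ⟨X.property.1⟩
    ⟨(leftTStructure E).ge_shift 0 n (-n) (by lia) _ Y.property.2⟩

/-- The cone of a morphism of the heart has cohomology only in degrees `-1` and `0`. Its truncation
triangle exhibits the kernel, shifted by one, and the cokernel. -/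
lemma admissibleMorphism_incl :
    AbelianSubcategory.admissibleMorphism (LH.incl E) = ⊤ := by
  ext X₁ X₂ f
  simp only [MorphismProperty.top_apply, iff_true]
  intro X₃ f₂ f₃ hT
  obtain ⟨A, B, hA, hB, α, β, γ, hT'⟩ := (leftTStructure E).exists_triangle X₃ (-1) 0 (by lia)
  have hA : leftLEAt (-1) A := hA
  have hB : leftGEAt 0 B := hB
  have h₁ : ∀ k, k ≠ 0 → VanishesAt k ((LH.incl E).obj X₁) := fun k hk => by
    obtain hk | hk := lt_or_gt_of_ne hk
    · exact leftGEAt_iff.1 X₁.property.2 k hk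
    · exact leftLEAt_iff.1 X₁.property.1 k hk
  have h₂ : ∀ k, k ≠ 0 → VanishesAt k ((LH.incl E).obj X₂) := fun k hk => by
    obtain hk | hk := lt_or_gt_of_ne hk
    · exact leftGEAt_iff.1 X₂.property.2 k hk
    · exact leftLEAt_iff.1 X₂.property.1 k hk
  have h₃ : ∀ k, k ≠ 0 → k ≠ -1 → VanishesAt k X₃ := fun k hk hk' =>
    VanishesAt.obj₃ rfl hT (h₂ k hk) (h₁ (k + 1) (by lia))
  have hA' : leftGEAt (-1) A := leftGEAt_iff.2 fun k hk =>
    VanishesAt.obj₁ (n' := k - 1) (by lia) hT' (h₃ k (by lia) (by lia))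
      (leftGEAt_iff.1 hB _ (by lia))
  have hB' : leftLEAt 0 B := leftLEAt_iff.2 fun k hk =>
    VanishesAt.obj₃ rfl hT' (h₃ k (by lia) (by lia)) (leftLEAt_iff.1 hA _ (by lia))
  let K : LH E := ⟨A⟦(-1 : ℤ)⟧, (leftTStructure E).le_shift (-1) (-1) 0 (by lia) A hA,
    (leftTStructure E).ge_shift (-1) (-1) 0 (by lia) A hA'⟩
  let e : ((LH.incl E).obj K)⟦(1 : ℤ)⟧ ≅ A := (shiftEquiv (D E) (1 : ℤ)).counitIso.app A
  exact ⟨K, ⟨B, hB', hB⟩, e.hom ≫ α, β, γ ≫ e.inv⟦(1 : ℤ)⟧', distinguished_of_iso₁ hT' e.symm⟩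

instance : Abelian (LH E) :=
  AbelianSubcategory.abelian (LH.incl E) heart_hom_shift_eq_zero admissibleMorphism_incl

/-- An epimorphism of the heart completes to a triangle whose first vertex is a kernel, and kernels
are unique up to isomorphism. -/
lemma exists_distinguished_of_shortExact {S : ShortComplex (LH E)} (hS : S.ShortExact) :
    ∃ δ, Triangle.mk ((LH.incl E).map S.f) ((LH.incl E).map S.g) δ ∈ distTriang (D E) := by
  have := hS.epi_g
  obtain ⟨X, i, δ, hT⟩ := AbelianSubcategory.exists_distinguished_triangle_of_epi
    heart_hom_shift_eq_zero admissibleMorphism_incl S.g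
  obtain ⟨e, he⟩ : ∃ e : X ≅ S.X₁, e.hom ≫ S.f = i :=
    ⟨_, IsLimit.conePointUniqueUpToIso_hom_comp (AbelianSubcategory.isLimitKernelForkOfDistTriang
      heart_hom_shift_eq_zero _ _ _ hT) hS.fIsKernel WalkingParallelPair.zero⟩
  have hf : ((LH.incl E).mapIso e).inv ≫ (LH.incl E).map i = (LH.incl E).map S.f := by
    rw [← he, Functor.mapIso_inv, ← Functor.map_comp, e.inv_hom_id_assoc]
  have hT' := distinguished_of_iso₁ hT ((LH.incl E).mapIso e)
  rw [hf] at hT'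
  exact ⟨_, hT'⟩

lemma shortExact_of_distinguished {X Y Z : LH E} (f : X ⟶ Y) (g : Y ⟶ Z) (w : f ≫ g = 0)
    (δ : (LH.incl E).obj Z ⟶ ((LH.incl E).obj X)⟦(1 : ℤ)⟧)
    (hT : Triangle.mk ((LH.incl E).map f) ((LH.incl E).map g) δ ∈ distTriang (D E)) :
    (ShortComplex.mk f g w).ShortExact :=
  have hl := AbelianSubcategory.isLimitKernelForkOfDistTriang heart_hom_shift_eq_zero f g δ hT
  have hc := AbelianSubcategory.isColimitCokernelCoforkOfDistTriang
    heart_hom_shift_eq_zero f g δ hT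
  { exact := ShortComplex.exact_of_f_is_kernel _ hl
    mono_f := mono_of_isLimit_fork hl
    epi_g := epi_of_isColimit_cofork hc }

end Heart

/-! ### Derived functors of functors preserving strict exactness -/

section ExactFunctor

universe v w

variable {E : Type w} [Category.{v} E] [Preadditive E] [HasKernels E] [HasCokernels E]
  [HasZeroObject E] [HasBinaryBiproducts E]

/-- A functor which preserves strictly exact sequences. -/
def PreservesStrictExactness (F : E ⥤ E) [F.Additive] : Prop :=
  ∀ S : ShortComplex E, IsStrictlyExact S → IsStrictlyExact (S.map F)

variable {F : E ⥤ E} [F.Additive] (hF : PreservesStrictExactness F)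

include hF

lemma PreservesStrictExactness.strictlyExactAt {X : K E} {n : ℤ} (h : StrictlyExactAt X.as n) :
    StrictlyExactAt ((F.mapHomotopyCategory (.up ℤ)).obj X).as n := by
  have h' : IsStrictlyExact ((X.as.sc n).map F) := hF (X.as.sc n) h
  change IsStrictlyExact (((F.mapHomologicalComplex (.up ℤ)).obj X.as).sc n)
  exact h'

lemma PreservesStrictExactness.isInvertedBy :
    (strictQis E).IsInvertedBy (F.mapHomotopyCategory (.up ℤ) ⋙ Q E) := by
  rintro X Y f ⟨Z, g, h, hT, hZ⟩
  exact Localization.inverts (Q E) (strictQis E) _ (ObjectProperty.trW.mk (strictlyAcyclic E)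
    ((F.mapHomotopyCategory (.up ℤ)).map_distinguished _ hT) fun n => hF.strictlyExactAt (hZ n))

variable [HasStrictGenerators E] {RF : D E ⥤ D E}
    {α : F.mapHomotopyCategory (.up ℤ) ⋙ Q E ⟶ Q E ⋙ RF}

/-- The termwise functor already inverts the localised morphisms, so `α` is invertible and `RF` is
computed on any representative. -/
lemma PreservesStrictExactness.vanishesAt (hα : RF.IsRightDerivedFunctor α (strictQis E))
    {X : D E} {n : ℤ} (h : VanishesAt n X) : VanishesAt n (RF.obj X) := by
  have := Functor.isIso_of_isRightDerivedFunctor_of_inverts RF α hF.isInvertedBy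
  have := Localization.essSurj (Q E) (strictQis E)
  let e := (Q E).objObjPreimageIso X
  have h' := (vanishesAt_Q_iff n _).1 (h.of_iso e.symm)
  exact ((vanishesAt_Q_iff n _).2 (hF.strictlyExactAt h')).of_iso
    ((asIso α).app _ ≪≫ RF.mapIso e)

lemma PreservesStrictExactness.prop_obj (hα : RF.IsRightDerivedFunctor α (strictQis E))
    (X : LH E) : (leftLE E ⊓ leftGE E) ((LH.incl E ⋙ RF).obj X) :=
  ⟨leftLEAt_iff.2 fun k hk => hF.vanishesAt hα (leftLEAt_iff.1 X.property.1 k hk),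
    leftGEAt_iff.2 fun k hk => hF.vanishesAt hα (leftGEAt_iff.1 X.property.2 k hk)⟩

omit hF in
lemma isLeftCohomologyZero_lift {A : Type*} [Category* A] (G : A ⥤ D E)
    (hG : ∀ X, (leftLE E ⊓ leftGE E) (G.obj X)) :
    IsLeftCohomologyZero G ((leftLE E ⊓ leftGE E).lift G hG) := by
  refine ⟨G, 𝟙 G, 𝟙 G, fun V => ⟨(hG V).1, fun X _ => ?_, fun X _ => ?_⟩⟩
  · convert Function.bijective_id using 1
    ext f
    exact Category.comp_id f
  · convert Function.bijective_id using 1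
    ext f
    exact Category.id_comp f

omit hF [F.Additive] in
-- For values already in the heart, both universal arrows `a` and `b` are invertible: the inverses
-- come from the universal properties applied to identities.
lemma IsLeftCohomologyZero.nonempty_iso {A : Type*} [Category* A] {G : A ⥤ D E} {H : A ⥤ LH E}
    (hG : ∀ X, (leftLE E ⊓ leftGE E) (G.obj X)) (h : IsLeftCohomologyZero G H) :
    Nonempty (G ≅ H ⋙ LH.incl E) := by
  obtain ⟨Y, a, b, h⟩ := h
  have ha : ∀ V, IsIso (a.app V) := fun V => by
    obtain ⟨hY, hl, -⟩ := h V
    obtain ⟨f, hf⟩ := (hl _ (hG V).1).2 (𝟙 _)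
    dsimp only at hf
    exact ⟨f, (hl _ hY).1 (by simp [hf]), hf⟩
  have hb : ∀ V, IsIso (b.app V) := fun V => by
    obtain ⟨hY, -, hr⟩ := h V
    have hY' : leftGE E (Y.obj V) :=
      (leftGEAt (E := E) 0).prop_of_iso (@asIso _ _ _ _ _ (ha V)).symm (hG V).2
    obtain ⟨f, hf⟩ := (hr _ hY').2 (𝟙 _)
    dsimp only at hf
    exact ⟨f, hf, (hr _ (H.obj V).property.2).1 (by
      change b.app V ≫ f ≫ b.app V = b.app V ≫ 𝟙 _
      rw [reassoc_of% hf, Category.comp_id])⟩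
  have := NatIso.isIso_of_isIso_app a
  have := NatIso.isIso_of_isIso_app b
  exact ⟨(asIso a).symm ≪≫ asIso b⟩

/-- Restricting the derived functor of an exact functor to the left heart gives an endofunctor. -/
theorem PreservesStrictExactness.exists_isLeftCohomologyZero :
    ∃ (H : LH E ⥤ LH E) (RF : D E ⥤ D E)
      (α : F.mapHomotopyCategory (.up ℤ) ⋙ Q E ⟶ Q E ⋙ RF),
      RF.IsRightDerivedFunctor α (strictQis E) ∧ IsLeftCohomologyZero (LH.incl E ⋙ RF) H := by
  have h := Functor.isRightDerivedFunctor_of_inverts (strictQis E) _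
    (Localization.fac _ hF.isInvertedBy (Q E))
  exact ⟨_, _, _, h, isLeftCohomologyZero_lift _ (hF.prop_obj h)⟩

omit hF [F.Additive] in
-- Short exact sequences of the heart are triangles; `G` preserves triangles, and `e` carries the
-- image triangle back into the heart.
lemma preservesFiniteLimits_and_colimits_of_isTriangulated {G : D E ⥤ D E} [G.CommShift ℤ]
    [G.IsTriangulated] {H : LH E ⥤ LH E} (e : LH.incl E ⋙ G ≅ H ⋙ LH.incl E) :
    PreservesFiniteLimits H ∧ PreservesFiniteColimits H := by
  have : (H ⋙ LH.incl E).Additive := Functor.additive_of_iso e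
  have : H.Additive := Functor.additive_of_comp_faithful H (LH.incl E)
  refine ((Functor.exact_tfae H).out 0 3).1 fun S hS => ?_
  obtain ⟨δ, hT⟩ := exists_distinguished_of_shortExact hS
  refine shortExact_of_distinguished _ _ _
    (e.inv.app S.X₃ ≫ G.map δ ≫ (G.commShiftIso (1 : ℤ)).hom.app _ ≫ (e.hom.app S.X₁)⟦(1 : ℤ)⟧')
    (isomorphic_distinguished _ (G.map_distinguished _ hT) _
      (Triangle.isoMk _ _ (e.symm.app _) (e.symm.app _) (e.symm.app _)
        (e.inv.naturality S.f) (e.inv.naturality S.g) ?_))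
  change (e.inv.app S.X₃ ≫ G.map δ ≫ (G.commShiftIso (1 : ℤ)).hom.app _ ≫
    (e.hom.app S.X₁)⟦(1 : ℤ)⟧') ≫ (e.inv.app S.X₁)⟦(1 : ℤ)⟧' =
      e.inv.app S.X₃ ≫ G.map δ ≫ (G.commShiftIso (1 : ℤ)).hom.app _
  simp only [Category.assoc, ← Functor.map_comp, Iso.hom_inv_id_app]
  erw [CategoryTheory.Functor.map_id, Category.comp_id]

theorem PreservesStrictExactness.preservesFiniteLimits_and_colimits
    (hα : RF.IsRightDerivedFunctor α (strictQis E)) {H : LH E ⥤ LH E}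
    (hH : IsLeftCohomologyZero (LH.incl E ⋙ RF) H) :
    PreservesFiniteLimits H ∧ PreservesFiniteColimits H := by
  have := Functor.isIso_of_isRightDerivedFunctor_of_inverts RF α hF.isInvertedBy
  let i : Localization.Lifting (Q E) (strictQis E) (F.mapHomotopyCategory (.up ℤ) ⋙ Q E) RF :=
    ⟨(asIso α).symm⟩
  let c : RF.CommShift ℤ := Functor.commShiftOfLocalization (Q E) (strictQis E) ℤ
    (F.mapHomotopyCategory (.up ℤ) ⋙ Q E) RF
  have := Localization.essSurj_mapArrow (Q E) (strictQis E)
  have : NatTrans.CommShift (asIso α).symm.hom ℤ := inferInstanceAs (NatTrans.CommShift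
    (Localization.Lifting.iso (Q E) (strictQis E) (F.mapHomotopyCategory (.up ℤ) ⋙ Q E) RF).hom ℤ)
  have : RF.IsTriangulated := Functor.isTriangulated_of_precomp_iso (asIso α).symm
  obtain ⟨e⟩ := hH.nonempty_iso (hF.prop_obj hα)
  exact preservesFiniteLimits_and_colimits_of_isTriangulated e

end ExactFunctor

/-! ### Strict epimorphisms and strictly projective Banach modules -/

namespace BanMod

variable {R : Type u} [NormedCommRing R]

/-- A bounded linear map is a strict epimorphism if every element has a preimage of comparable
norm. -/
def StrictSurj {M N : BanMod R} (f : M ⟶ N) : Prop :=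
  ∃ C : ℝ, 0 ≤ C ∧ ∀ y, ∃ x, f.toLin x = y ∧ ‖x‖ ≤ C * ‖y‖

/-- A Banach module `M` is strictly projective if `Hom(M, -)` preserves strict epimorphisms. -/
def StrictProjective (M : BanMod R) : Prop :=
  ∀ ⦃X Y : BanMod R⦄ (f : X ⟶ Y), StrictSurj f → StrictSurj (ihomMap M f)

lemma Hom.exists_nonneg_bound {M N : BanMod R} (f : M ⟶ N) :
    ∃ C : ℝ, 0 ≤ C ∧ ∀ x, ‖f.toLin x‖ ≤ C * ‖x‖ := by
  obtain ⟨C, hC⟩ := f.bounded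
  exact ⟨|C|, abs_nonneg C, fun x =>
    (hC x).trans (mul_le_mul_of_nonneg_right (le_abs_self C) (norm_nonneg x))⟩

lemma StrictSurj.surjective {M N : BanMod R} {f : M ⟶ N} (hf : StrictSurj f) :
    Function.Surjective f.toLin := fun y => by
  obtain ⟨C, -, h⟩ := hf
  obtain ⟨x, hx, -⟩ := h y
  exact ⟨x, hx⟩

lemma StrictProjective.exists_lift {P : BanMod R} (hP : StrictProjective P) {X Y : BanMod R}
    {f : X ⟶ Y} (hf : StrictSurj f) (g : P ⟶ Y) : ∃ h : P ⟶ X, h ≫ f = g := by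
  obtain ⟨h, hh⟩ := (hP f hf).surjective (homEquiv _ _ g)
  exact ⟨(homEquiv _ _).symm h, congrArg (homEquiv _ _).symm hh⟩

/-- A bounded set-theoretic section `s` suffices: `g` kills the kernel of `q`, so `g ∘ s` is linear
although `s` need not be. -/
lemma StrictSurj.exists_desc {X Y T : BanMod R} {q : X ⟶ Y} (hq : StrictSurj q) (g : X ⟶ T)
    (h : ∀ x, q.toLin x = 0 → g.toLin x = 0) : ∃ g' : Y ⟶ T, q ≫ g' = g := by
  obtain ⟨C, hC, hC'⟩ := hq
  choose s hs hs' using hC'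
  have key : ∀ x y, q.toLin x = y → g.toLin x = g.toLin (s y) := fun x y hxy => by
    rw [← sub_eq_zero, ← map_sub]
    exact h _ (by rw [map_sub, hs, hxy, sub_self])
  obtain ⟨D, hD, hD'⟩ := g.exists_nonneg_bound
  refine ⟨⟨{ toFun y := g.toLin (s y)
             map_add' a b := ?_
             map_smul' r a := ?_ }, D * C, fun y => ?_⟩, ?_⟩
  · rw [← map_add]
    exact (key _ _ (by rw [map_add, hs, hs])).symm
  · rw [RingHom.id_apply, ← map_smul]
    exact (key _ _ (by rw [map_smul, hs])).symm
  · rw [mul_assoc]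
    exact (hD' _).trans (mul_le_mul_of_nonneg_left (hs' y) hD)
  · ext x
    exact (key x _ rfl).symm

/-- A strict epimorphism is the cokernel of any map onto its kernel. -/
lemma StrictSurj.nonempty_isColimit {K X Y : BanMod R} {q : X ⟶ Y} (hq : StrictSurj q)
    (k : K ⟶ X) (w : k ≫ q = 0) (hk : ∀ x, q.toLin x = 0 → ∃ z, k.toLin z = x) :
    Nonempty (IsColimit (CokernelCofork.ofπ q w)) := by
  have hd : ∀ {T : BanMod R} (g : X ⟶ T), k ≫ g = 0 → ∃ g' : Y ⟶ T, q ≫ g' = g :=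
    fun g hg => hq.exists_desc g fun x hx => by
      obtain ⟨z, rfl⟩ := hk x hx
      exact LinearMap.congr_fun (congrArg Hom.toLin hg) z
  refine ⟨CokernelCofork.IsColimit.ofπ q w (fun g hg => (hd g hg).choose)
    (fun g hg => (hd g hg).choose_spec) fun g hg m hm => ?_⟩
  ext y
  obtain ⟨x, rfl⟩ := hq.surjective y
  exact LinearMap.congr_fun (congrArg Hom.toLin (hm.trans (hd g hg).choose_spec.symm)) x

/-- The inclusion of the kernel. -/
def kerι {X Y : BanMod R} (f : X ⟶ Y) : ker f ⟶ X :=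
  ⟨(LinearMap.ker f.toLin).subtype, 1, fun x => by rw [one_mul]; exact le_rfl⟩

lemma kerι_comp {X Y : BanMod R} (f : X ⟶ Y) : kerι f ≫ f = 0 := by
  ext x
  exact x.2

/-- The projection onto the cokernel. -/
def cokerπ {X Y : BanMod R} (f : X ⟶ Y) : Y ⟶ coker f :=
  ⟨(LinearMap.range f.toLin).topologicalClosure.mkQ, 1, fun x => by
    rw [one_mul]; exact Submodule.Quotient.norm_mk_le _ _⟩

lemma comp_cokerπ {X Y : BanMod R} (f : X ⟶ Y) : f ≫ cokerπ f = 0 := by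
  ext x
  exact (Submodule.Quotient.mk_eq_zero _).2 (Submodule.le_topologicalClosure _ ⟨x, rfl⟩)

lemma strictSurj_cokerπ {X Y : BanMod R} (f : X ⟶ Y) : StrictSurj (cokerπ f) := by
  -- The residue norm is an infimum that need not be attained; for `y ≠ 0` a representative of norm
  -- less than `‖y‖ + ‖y‖` exists.
  refine ⟨2, by norm_num, fun y => ?_⟩
  obtain rfl | hy := eq_or_ne y 0
  · exact ⟨0, map_zero _, by simp⟩
  · obtain ⟨x, hx, hx'⟩ := Submodule.Quotient.norm_mk_lt (S := (LinearMap.range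
      f.toLin).topologicalClosure) y (norm_pos_iff.2 hy)
    exact ⟨x, hx, hx'.le.trans (two_mul ‖y‖).ge⟩

lemma strictSurj_of_isColimit {K X : BanMod R} {k : K ⟶ X} (c : CokernelCofork k)
    (hc : IsColimit c) : StrictSurj c.π := by
  obtain ⟨d, hd⟩ : ∃ d : c.pt ⟶ coker k, c.π ≫ d = cokerπ k :=
    ⟨_, hc.fac (CokernelCofork.ofπ (cokerπ k) (comp_cokerπ k)) WalkingParallelPair.one⟩
  -- By continuity `c.π` kills the closure of the range of `k`, not only the range.
  obtain ⟨d', hd'⟩ := (strictSurj_cokerπ k).exists_desc c.π fun x hx => by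
    have h : LinearMap.range k.toLin ≤ LinearMap.ker (Hom.toLin c.π) := by
      rintro _ ⟨z, rfl⟩
      exact LinearMap.congr_fun (congrArg Hom.toLin (CokernelCofork.condition c)) z
    exact Submodule.topologicalClosure_minimal _ h
      (isClosed_singleton.preimage (Hom.continuous c.π)) ((Submodule.Quotient.mk_eq_zero _).1 hx)
  have hdd : d ≫ d' = 𝟙 c.pt := by
    refine Cofork.IsColimit.hom_ext hc ?_
    rw [reassoc_of% hd, hd', Category.comp_id]
  obtain ⟨C, hC, h⟩ := strictSurj_cokerπ k
  obtain ⟨B, hB, hB'⟩ := d.exists_nonneg_bound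
  refine ⟨C * B, mul_nonneg hC hB, fun y => ?_⟩
  obtain ⟨x, hx, hx'⟩ := h (d.toLin y)
  refine ⟨x, ?_, ?_⟩
  · rw [← hd', comp_toLin, LinearMap.comp_apply, hx]
    exact LinearMap.congr_fun (congrArg Hom.toLin hdd) y
  · rw [mul_assoc]
    exact hx'.trans (mul_le_mul_of_nonneg_left (hB' y) hC)

lemma StrictProjective.of_retract {M P : BanMod R} (hP : StrictProjective P) (i : M ⟶ P)
    (r : P ⟶ M) (h : i ≫ r = 𝟙 M) : StrictProjective M := fun X Y f hf => by
  obtain ⟨C, hC, hC'⟩ := hP f hf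
  obtain ⟨A, hA, hA'⟩ := i.exists_nonneg_bound
  obtain ⟨B, hB, hB'⟩ := r.exists_nonneg_bound
  refine ⟨A * C * B, by positivity, fun g => ?_⟩
  let g' : M ⟶ Y := (homEquiv M Y).symm g
  obtain ⟨l, hl, hl'⟩ := hC' (homEquiv P Y (r ≫ g'))
  let l' : P ⟶ X := (homEquiv P X).symm l
  have hlf : l' ≫ f = r ≫ g' := congrArg (homEquiv P Y).symm hl
  refine ⟨homEquiv M X (i ≫ l'), congrArg (homEquiv M Y) (show (i ≫ l') ≫ f = g' by
    rw [Category.assoc, hlf, reassoc_of% h]), ?_⟩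
  have h1 : opNorm (homEquiv P Y (r ≫ g')) ≤ B * opNorm g := by
    refine (opNorm_le_iff _ (mul_nonneg hB (opNorm_nonneg g))).2 fun x => ?_
    calc ‖g.1 (r.toLin x)‖ ≤ opNorm g * ‖r.toLin x‖ := le_opNorm g _
      _ ≤ opNorm g * (B * ‖x‖) := mul_le_mul_of_nonneg_left (hB' x) (opNorm_nonneg g)
      _ = _ := by ring
  have h2 : opNorm l ≤ C * (B * opNorm g) := le_trans hl' (mul_le_mul_of_nonneg_left h1 hC)
  refine (opNorm_le_iff _ (mul_nonneg (by positivity) (opNorm_nonneg g))).2 fun x => ?_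
  calc ‖l.1 (i.toLin x)‖ ≤ opNorm l * ‖i.toLin x‖ := le_opNorm l _
    _ ≤ (C * (B * opNorm g)) * (A * ‖x‖) :=
      mul_le_mul h2 (hA' x) (norm_nonneg _)
        (mul_nonneg hC (mul_nonneg hB (opNorm_nonneg g)))
    _ = _ := by ring

end BanMod

/-! ### Weighted null families -/

section ZeroSequences

variable {R : Type u} [NormedCommRing R] {S : Type u} {w : S → ℝ}

/-- The families `a : S → R` such that `‖a s‖ * w s` tends to zero. -/
def c0Module (R : Type u) [NormedCommRing R] {S : Type u} {w : S → ℝ} (hw : ∀ s, 0 < w s) :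
    Submodule R (S → R) where
  carrier := {a | Tendsto (fun s => ‖a s‖ * w s) cofinite (𝓝 0)}
  zero_mem' := by simpa using tendsto_const_nhds
  add_mem' {a b} ha hb := by
    refine squeeze_zero (fun s => mul_nonneg (norm_nonneg _) (hw s).le) (fun s => ?_)
      (by simpa using Tendsto.add ha hb)
    rw [← add_mul]
    exact mul_le_mul_of_nonneg_right (norm_add_le _ _) (hw s).le
  smul_mem' r a ha := by
    refine squeeze_zero (fun s => mul_nonneg (norm_nonneg _) (hw s).le) (fun s => ?_)
      (by simpa using Tendsto.const_mul ‖r‖ ha)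
    rw [← mul_assoc]
    exact mul_le_mul_of_nonneg_right (norm_mul_le _ _) (hw s).le

variable {hw : ∀ s, 0 < w s}

/-- The weighted supremum norm. -/
def c0Norm (a : c0Module R hw) : ℝ := ⨆ s, ‖a.1 s‖ * w s

lemma c0Norm_nonneg (a : c0Module R hw) : 0 ≤ c0Norm a :=
  Real.iSup_nonneg fun s => mul_nonneg (norm_nonneg _) (hw s).le

lemma c0Norm_le_iff (a : c0Module R hw) {c : ℝ} (hc : 0 ≤ c) :
    c0Norm a ≤ c ↔ ∀ s, ‖a.1 s‖ * w s ≤ c :=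
  ⟨fun h s => (le_ciSup (f := fun s => ‖a.1 s‖ * w s)
    (Tendsto.bddAbove_range_of_cofinite a.2) s).trans h, fun h => Real.iSup_le h hc⟩

lemma le_c0Norm (a : c0Module R hw) (s : S) : ‖a.1 s‖ * w s ≤ c0Norm a :=
  (c0Norm_le_iff a (c0Norm_nonneg a)).1 le_rfl s

lemma c0Norm_add_le_max [IsUltrametricDist R] (a b : c0Module R hw) :
    c0Norm (a + b) ≤ max (c0Norm a) (c0Norm b) := by
  refine (c0Norm_le_iff _ (le_max_of_le_left (c0Norm_nonneg a))).2 fun s => ?_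
  refine le_trans ?_ (max_le_max (le_c0Norm a s) (le_c0Norm b s))
  rw [← max_mul_of_nonneg _ _ (hw s).le]
  exact mul_le_mul_of_nonneg_right (IsUltrametricDist.norm_add_le_max _ _) (hw s).le

/-- The weighted supremum norm makes the families tending to zero a normed group. -/
abbrev c0Normed [IsUltrametricDist R] (hw : ∀ s, 0 < w s) : NormedAddCommGroup (c0Module R hw) :=
  AddGroupNorm.toNormedAddCommGroup
    { toFun := c0Norm
      map_zero' := le_antisymm ((c0Norm_le_iff _ le_rfl).2 fun s => by simp) (c0Norm_nonneg _)
      add_le' := fun a b => (c0Norm_add_le_max a b).trans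
        (max_le_add_of_nonneg (c0Norm_nonneg a) (c0Norm_nonneg b))
      neg' := fun a => by
        unfold c0Norm
        congr 1
        ext x
        simp
      eq_zero_of_map_eq_zero' := fun a ha => by
        ext s
        have h := le_c0Norm a s
        change c0Norm a = 0 at ha
        rw [ha] at h
        exact norm_le_zero_iff.1 (nonpos_of_mul_nonpos_left h (hw s)) }

namespace BanMod

variable [IsUltrametricDist R] [CompleteSpace R]

/-- The Banach module of families `a : S → R` such that `‖a s‖ * w s` tends to zero. -/
def c0 (R : Type u) [NormedCommRing R] [IsUltrametricDist R] [CompleteSpace R]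
    {S : Type u} {w : S → ℝ} (hw : ∀ s, 0 < w s) : BanMod R :=
  letI := c0Normed (R := R) hw
  { carrier := c0Module R hw
    ultrametric :=
      IsUltrametricDist.isUltrametricDist_of_forall_norm_add_le_max_norm c0Norm_add_le_max
    complete := by
      refine completeSpace_of_eval (ι := S) (W := fun _ => R)
        (fun s => { toFun := fun a => a.1 s, map_zero' := rfl, map_add' := fun _ _ => rfl })
        (fun s => (w s)⁻¹) (fun a c hc => ?_) fun y hy => ?_
      · refine (c0Norm_le_iff a hc).trans (forall_congr' fun s => ?_)
        rw [← div_eq_mul_inv, le_div_iff₀ (hw s)]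
        rfl
      · change ∀ ε > 0, ∃ v : c0Module R hw, ∀ s, ‖v.1 s - y s‖ ≤ ε * (w s)⁻¹ at hy
        refine ⟨⟨y, ?_⟩, fun s => rfl⟩
        change Tendsto _ _ _
        rw [Metric.tendsto_nhds]
        intro ε hε
        obtain ⟨v, hv⟩ := hy (ε / 2) (half_pos hε)
        filter_upwards [(Metric.tendsto_nhds.1 v.2) (ε / 2) (half_pos hε)] with s h
        rw [Real.dist_0_eq_abs, abs_of_nonneg (mul_nonneg (norm_nonneg _) (hw s).le)] at h ⊢
        have h1 := hv s
        rw [← div_eq_mul_inv, le_div_iff₀ (hw s)] at h1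
        have e : ‖y s‖ ≤ ‖v.1 s‖ + ‖v.1 s - y s‖ := by
          simpa using norm_sub_le (v.1 s) (v.1 s - y s)
        calc ‖y s‖ * w s ≤ (‖v.1 s‖ + ‖v.1 s - y s‖) * w s :=
              mul_le_mul_of_nonneg_right e (hw s).le
          _ < ε := by rw [add_mul]; linarith
    bounded_smul := by
      refine ⟨1, one_pos, fun r a =>
        (c0Norm_le_iff _ (mul_nonneg (by positivity) (c0Norm_nonneg a))).2 fun s => ?_⟩
      change ‖r * a.1 s‖ * _ ≤ 1 * ‖r‖ * c0Norm a
      calc ‖r * a.1 s‖ * w s ≤ ‖r‖ * ‖a.1 s‖ * w s :=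
            mul_le_mul_of_nonneg_right (norm_mul_le _ _) (hw s).le
        _ ≤ _ := by
          rw [one_mul, mul_assoc]
          exact mul_le_mul_of_nonneg_left (le_c0Norm a s) (norm_nonneg _) }

/-- A coordinate of a family in `c0`. -/
def c0Coord (a : c0 R hw) (s : S) : R := a.1 s

lemma c0_norm_le_iff (a : c0 R hw) {c : ℝ} (hc : 0 ≤ c) :
    ‖a‖ ≤ c ↔ ∀ s, ‖c0Coord a s‖ * w s ≤ c :=
  c0Norm_le_iff (hw := hw) a hc

lemma c0_le_norm (a : c0 R hw) (s : S) : ‖c0Coord a s‖ * w s ≤ ‖a‖ := le_c0Norm (hw := hw) a s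

lemma c0_tendsto (a : c0 R hw) : Tendsto (fun s => ‖c0Coord a s‖ * w s) cofinite (𝓝 0) := a.2

open Classical in
/-- The standard generators of `c0`. -/
def c0Single (hw : ∀ s, 0 < w s) (s : S) : c0 R hw :=
  ⟨Pi.single s 1, by
    refine tendsto_const_nhds.congr' ?_
    filter_upwards [(Set.finite_singleton s).compl_mem_cofinite] with t ht
    simp [Pi.single_eq_of_ne (show t ≠ s from ht)]⟩

open Classical in
lemma c0Coord_single (s t : S) :
    c0Coord (c0Single (R := R) hw s) t = if t = s then 1 else 0 :=
  Pi.single_apply s (1 : R) t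

lemma norm_c0Single_le (s : S) : ‖c0Single (R := R) hw s‖ ≤ ‖(1 : R)‖ * w s := by
  refine (c0_norm_le_iff _ (mul_nonneg (norm_nonneg _) (hw s).le)).2 fun t => ?_
  rw [c0Coord_single]
  split_ifs with h
  · rw [h]
  · simpa using mul_nonneg (norm_nonneg (1 : R)) (hw s).le

/-- Evaluation at a coordinate. -/
def c0Eval (s : S) : c0 R hw →ₗ[R] R :=
  LinearMap.proj s ∘ₗ (c0Module R hw).subtype

lemma c0_hasSum (a : c0 R hw) : HasSum (fun s => c0Coord a s • c0Single (R := R) hw s) a := by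
  classical
  rw [HasSum, SummationFilter.unconditional_filter, Metric.tendsto_atTop]
  intro ε hε
  have hfin := (Metric.tendsto_nhds.1 (c0_tendsto a)) (ε / 2) (half_pos hε)
  rw [eventually_cofinite] at hfin
  refine ⟨hfin.toFinset, fun T hT => ?_⟩
  rw [dist_eq_norm]
  refine lt_of_le_of_lt ((c0_norm_le_iff _ (half_pos hε).le).2 fun s => ?_) (half_lt_self hε)
  have e : c0Coord (∑ t ∈ T, c0Coord a t • c0Single (R := R) hw t - a) s
      = (if s ∈ T then c0Coord a s else 0) - c0Coord a s := by
    change c0Eval s (∑ t ∈ T, c0Coord a t • c0Single (R := R) hw t - a) = _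
    rw [map_sub, map_sum]
    congr 1
    simp_rw [map_smul]
    change ∑ t ∈ T, c0Coord a t • c0Coord (c0Single (R := R) hw t) s = _
    simp_rw [c0Coord_single]
    simp
  rw [e]
  split_ifs with h
  · simpa using (half_pos hε).le
  · have : s ∉ hfin.toFinset := fun h' => h (hT h')
    rw [Set.Finite.mem_toFinset] at this
    simp only [Set.mem_ofPred_eq, not_not] at this
    rw [Real.dist_0_eq_abs, abs_of_nonneg (mul_nonneg (norm_nonneg _) (hw s).le)] at this
    rw [zero_sub, norm_neg]
    exact this.le

/-- By `c0_hasSum` and continuity, a bounded map is determined on the standard generators. -/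
lemma c0_hom_ext {N : BanMod R} {f g : c0 R hw ⟶ N}
    (h : ∀ s, f.toLin (c0Single hw s) = g.toLin (c0Single hw s)) : f = g := by
  ext a
  have hf := (c0_hasSum a).map f.toLin f.continuous
  have hg := (c0_hasSum a).map g.toLin g.continuous
  have e : f.toLin ∘ (fun s => c0Coord a s • c0Single (R := R) hw s)
      = g.toLin ∘ fun s => c0Coord a s • c0Single (R := R) hw s := funext fun s => by
    simp only [Function.comp_apply, map_smul, h]
  rw [e] at hf
  exact hf.unique hg

/-- A family of elements whose norms are bounded by the weights extends to `c0`. -/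
lemma exists_c0_lift (N : BanMod R) : ∃ K : ℝ, 0 ≤ K ∧ ∀ {S : Type u} {w : S → ℝ}
    (hw : ∀ s, 0 < w s) (n : S → N) (D : ℝ), 0 ≤ D → (∀ s, ‖n s‖ ≤ D * w s) →
      ∃ g : c0 R hw ⟶ N, (∀ s, g.toLin (c0Single hw s) = n s) ∧ ∀ a, ‖g.toLin a‖ ≤ K * D * ‖a‖ := by
  obtain ⟨C, hC, hN⟩ := N.bounded_smul
  refine ⟨C, hC.le, fun {S w} hw n D hD hn => ?_⟩
  have hb : ∀ (a : c0 R hw) s, ‖c0Coord a s • n s‖ ≤ C * D * (‖c0Coord a s‖ * w s) := fun a s => by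
    calc ‖c0Coord a s • n s‖ ≤ C * ‖c0Coord a s‖ * ‖n s‖ := hN _ _
      _ ≤ C * ‖c0Coord a s‖ * (D * w s) := mul_le_mul_of_nonneg_left (hn s) (by positivity)
      _ = _ := by ring
  -- In a complete non-Archimedean group, every family tending to zero is summable.
  have hs : ∀ a : c0 R hw, Summable fun s => c0Coord a s • n s := fun a => by
    refine NonarchimedeanAddGroup.summable_of_tendsto_cofinite_zero ?_
    rw [tendsto_zero_iff_norm_tendsto_zero]
    exact squeeze_zero (fun s => norm_nonneg _) (hb a)
      (by simpa using (c0_tendsto a).const_mul (C * D))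
  have hbd : ∀ a : c0 R hw, ‖∑' s, c0Coord a s • n s‖ ≤ C * D * ‖a‖ := fun a => by
    refine (IsUltrametricDist.norm_tsum_le _).trans (Real.iSup_le (fun s => ?_) (by positivity))
    exact (hb a s).trans (mul_le_mul_of_nonneg_left (c0_le_norm a s) (by positivity))
  refine ⟨⟨{ toFun a := ∑' s, c0Coord a s • n s
             map_add' a b := ?_
             map_smul' r a := ?_ }, C * D, hbd⟩, fun s => ?_, hbd⟩
  · rw [← (hs a).tsum_add (hs b)]
    exact tsum_congr fun s => add_smul _ _ _
  · rw [RingHom.id_apply, ← (hs a).tsum_const_smul]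
    exact tsum_congr fun s => mul_smul _ _ _
  · change ∑' t, c0Coord (c0Single hw s) t • n t = n s
    classical
    rw [tsum_eq_single s fun t ht => by rw [c0Coord_single, if_neg ht, zero_smul],
      c0Coord_single, if_pos rfl, one_smul]

/-- Lift the images of the standard generators with a uniform norm bound and extend. The constant
involves only `f` and `X`, not `g`; the factor `‖1‖` appears because the norm of the unit need not
be 1. -/
lemma strictProjective_c0 (hw : ∀ s, 0 < w s) : StrictProjective (c0 R hw) := fun X Y f hf => by
  obtain ⟨C, hC, hf⟩ := hf
  obtain ⟨K, hK, hX⟩ := exists_c0_lift X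
  refine ⟨K * (C * ‖(1 : R)‖), by positivity, fun g => ?_⟩
  let g' : c0 R hw ⟶ Y := (homEquiv _ _).symm g
  choose n hn hn' using fun s => hf (g'.toLin (c0Single hw s))
  have hD : ∀ s, ‖n s‖ ≤ (C * ‖(1 : R)‖ * opNorm g) * w s := fun s => by
    calc ‖n s‖ ≤ C * ‖g'.toLin (c0Single hw s)‖ := hn' s
      _ ≤ C * (opNorm g * (‖(1 : R)‖ * w s)) := by
        refine mul_le_mul_of_nonneg_left ((le_opNorm g _).trans ?_) hC
        exact mul_le_mul_of_nonneg_left (norm_c0Single_le s) (opNorm_nonneg g)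
      _ = _ := by ring
  obtain ⟨l, hl, hl'⟩ := hX hw n _ (mul_nonneg (by positivity) (opNorm_nonneg g)) hD
  have e : l ≫ f = g' := c0_hom_ext fun s => by
    rw [comp_toLin, LinearMap.comp_apply, hl, hn]
  refine ⟨homEquiv _ _ l, congrArg (homEquiv _ _) e, ?_⟩
  refine (opNorm_le_iff _ (mul_nonneg (by positivity) (opNorm_nonneg g))).2 fun a => ?_
  exact (hl' a).trans_eq (by ring)

/-- There are enough strictly projective Banach modules. -/
lemma exists_strictProjective_cover (A : BanMod R) :
    ∃ (P : BanMod R) (p : P ⟶ A), StrictProjective P ∧ StrictSurj p := by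
  -- Each nonzero element is a generator weighted by its own norm, which gives preimages of
  -- comparable norm. Zero is left out because weights must be positive.
  have hw : ∀ s : {x : A // x ≠ 0}, 0 < ‖s.1‖ := fun s => norm_pos_iff.2 s.2
  obtain ⟨K, hK, hA⟩ := exists_c0_lift A
  obtain ⟨p, hp, -⟩ := hA hw (fun s => s.1) 1 zero_le_one fun s => (one_mul _).ge
  refine ⟨c0 R hw, p, strictProjective_c0 hw, ‖(1 : R)‖, norm_nonneg _, fun y => ?_⟩
  by_cases hy : y = 0
  · exact ⟨0, by rw [map_zero, hy], by simp [hy]⟩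
  · exact ⟨c0Single hw ⟨y, hy⟩, hp ⟨y, hy⟩, norm_c0Single_le _⟩

end BanMod

end ZeroSequences

/-! ### Strict projectivity of the Tate algebra -/

section Tate

variable (F : Type u) [NontriviallyNormedField F] [IsUltrametricDist F]

instance : IsUltrametricDist (integers F) := inferInstanceAs (IsUltrametricDist (Subtype _))

instance [CompleteSpace F] : CompleteSpace (integers F) := by
  have : IsClosed ((integers F : Set F)) := isClosed_le continuous_norm continuous_const
  exact this.completeSpace_coe

variable {F} [CompleteSpace F] {π : F}

lemma strictProjective_tate (hπ : π ≠ 0) (m d : ℕ) : BanMod.StrictProjective (tate hπ m d) := by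
  -- All weights are 1, since multiplying the coefficient of X^α by π^(m|α|) absorbs the gauge. The
  -- index set is lifted to the universe of `F`, as `c0` requires.
  have hw : ∀ _ : ULift.{u} (Fin d →₀ ℕ), (0 : ℝ) < 1 := fun _ => one_pos
  have hg : ∀ α : Fin d →₀ ℕ, π ^ (m * α.degree) ≠ 0 := fun α => pow_ne_zero _ hπ
  have hn : ∀ (x : F) (α : Fin d →₀ ℕ), ‖π ^ (m * α.degree) * x‖ = ‖x‖ * gauge π m d α :=
    fun x α => by rw [norm_mul, norm_pow, mul_comm, gauge]
  have hn' : ∀ (x : F) (α : Fin d →₀ ℕ), ‖(π ^ (m * α.degree))⁻¹ * x‖ * gauge π m d α = ‖x‖ :=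
    fun x α => by rw [← hn, mul_inv_cancel_left₀ (hg α)]
  have ht : ∀ b : BanMod.c0 (integers F) hw, Tendsto (fun α =>
      ‖BanMod.c0Coord b (ULift.up α)‖) cofinite (𝓝 0) := fun b => by
    have := (BanMod.c0_tendsto b).comp
      (ULift.up_injective (α := Fin d →₀ ℕ)).tendsto_cofinite
    simpa [Function.comp_def] using this
  let i : tate hπ m d ⟶ BanMod.c0 (integers F) hw :=
    ⟨{ toFun a := ⟨fun α => ⟨π ^ (m * α.down.degree) * MvPowerSeries.coeff α.down a.1, by
          change ‖_‖ ≤ 1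
          rw [hn]
          exact a.2.1 α.down⟩, by
            change Tendsto (fun α : ULift.{u} (Fin d →₀ ℕ) =>
              ‖π ^ (m * α.down.degree) * MvPowerSeries.coeff α.down a.1‖ * 1) _ _
            simp_rw [hn, mul_one]
            exact a.2.2.comp ULift.down_injective.tendsto_cofinite⟩
       map_add' a b := Subtype.ext (funext fun α => Subtype.ext (mul_add _ _ _))
       map_smul' r a := Subtype.ext (funext fun α => Subtype.ext (mul_left_comm _ _ _)) },
      1, fun a => by
        rw [one_mul]
        refine (BanMod.c0_norm_le_iff _ (norm_nonneg a)).2 fun α => ?_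
        change ‖π ^ (m * α.down.degree) * MvPowerSeries.coeff α.down a.1‖ * 1 ≤ _
        rw [hn, mul_one]
        exact le_gaussNorm a α.down⟩
  let r : BanMod.c0 (integers F) hw ⟶ tate hπ m d :=
    ⟨{ toFun b := ⟨fun α => (π ^ (m * α.degree))⁻¹ * ((BanMod.c0Coord b (ULift.up α) : integers F) : F), by
          constructor
          · intro α
            exact (hn' _ α).trans_le (BanMod.c0Coord b (ULift.up α)).2
          · exact (ht b).congr fun α => (hn' _ α).symm⟩
       map_add' a b := Subtype.ext (funext fun α => mul_add _ _ _)
       map_smul' r a := Subtype.ext (funext fun α => mul_left_comm _ _ _) },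
      1, fun b => by
        rw [one_mul]
        refine (gaussNorm_le_iff _).2 fun α => ?_
        refine (hn' _ α).trans_le ?_
        simpa using BanMod.c0_le_norm b (ULift.up α)⟩
  refine (BanMod.strictProjective_c0 hw).of_retract i r ?_
  ext a
  exact Subtype.ext (funext fun α => inv_mul_cancel_left₀ (hg α) _)

end Tate

/-! ### Compactness of constant ind-objects -/

section Ind

universe v w

variable {C : Type w} [Category.{v} C]

/-- Morphisms from an object of `C` to an ind-object are the elements of the presheaf. -/
def coyonedaIndYonedaIso (A : C) : coyoneda.obj (Opposite.op (Ind.yoneda.obj A)) ≅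
    Ind.inclusion C ⋙ (evaluation _ _).obj (Opposite.op A) :=
  NatIso.ofComponents (fun V => (((Ind.inclusion.fullyFaithful (C := C)).homEquiv.trans
    ((Ind.yonedaCompInclusion.app A).homCongr (Iso.refl _))).trans yonedaEquiv).toIso)
    (fun {V W} f => by
      ext x
      simp [yonedaEquiv, Functor.FullyFaithful.homEquiv])

instance (A : C) {J : Type v} [SmallCategory J] [IsFiltered J] :
    PreservesColimitsOfShape J (coyoneda.obj (Opposite.op (Ind.yoneda.obj A))) :=
  preservesColimitsOfShape_of_natIso (coyonedaIndYonedaIso A).symm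

variable {J : Type v} [SmallCategory J] [IsFiltered J] {F : J ⥤ Ind C} {c : Cocone F}
  (hc : IsColimit c)

include hc

lemma exists_comp_ι_app_eq {A : C} (x : Ind.yoneda.obj A ⟶ c.pt) :
    ∃ (j : J) (y : Ind.yoneda.obj A ⟶ F.obj j), y ≫ c.ι.app j = x :=
  Types.jointly_surjective_of_isColimit
    (isColimitOfPreserves (coyoneda.obj (Opposite.op (Ind.yoneda.obj A))) hc) x

lemma exists_comp_map_eq {A : C} {j : J} {x y : Ind.yoneda.obj A ⟶ F.obj j}
    (h : x ≫ c.ι.app j = y ≫ c.ι.app j) :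
    ∃ (k : J) (f : j ⟶ k), x ≫ F.map f = y ≫ F.map f :=
  (Types.FilteredColimit.isColimit_eq_iff' (isColimitOfPreserves
    (coyoneda.obj (Opposite.op (Ind.yoneda.obj A))) hc) x y).1 h

omit hc

lemma isIso_of_bijective_comp {V W : Ind C} (j : V ⟶ W)
    (h : ∀ A : C, Function.Bijective fun x : Ind.yoneda.obj A ⟶ V => x ≫ j) : IsIso j := by
  have : ∀ A, IsIso (((Ind.inclusion C).map j).app A) := fun A => by
    refine (NatIso.isIso_map_iff (coyonedaIndYonedaIso A.unop) j).1 ?_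
    rw [isIso_iff_bijective]
    exact h A.unop
  have : IsIso ((Ind.inclusion C).map j) := NatIso.isIso_of_isIso_app _
  exact isIso_of_reflects_iso j (Ind.inclusion C)

end Ind

/-! ### Strict exactness of ind-Banach modules and the internal Hom -/

namespace IndBan

open BanMod

variable {R : Type u} [NormedCommRing R]

/-- Morphisms from a strictly projective Banach module lift along cokernels. -/
lemma exists_lift_of_isColimit {P : BanMod R} (hP : StrictProjective P) {V W : IndBan R}
    {k : V ⟶ W} (c : CokernelCofork k) (hc : IsColimit c) (x : Ind.yoneda.obj P ⟶ c.pt) :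
    ∃ y : Ind.yoneda.obj P ⟶ W, y ≫ c.π = x := by
  -- A morphism of ind-objects comes from a natural transformation of filtered diagrams, so its
  -- cokernel can be formed levelwise.
  obtain ⟨I, _, _, F, G, φ, ⟨e⟩⟩ := Ind.exists_nonempty_arrow_mk_iso_ind_lim (f := k)
  let q := cokernel.π φ
  have hq := CokernelCofork.mapIsColimit _ (cokernelIsCokernel φ) (Ind.lim I)
  obtain ⟨f, f', g, g', h1, h2, h3⟩ : ∃ (f : V ⟶ (Ind.lim I).obj F) (f' : (Ind.lim I).obj F ⟶ V)
      (g : W ⟶ (Ind.lim I).obj G) (g' : (Ind.lim I).obj G ⟶ W),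
      k ≫ g = f ≫ (Ind.lim I).map φ ∧ (Ind.lim I).map φ ≫ g' = f' ≫ k ∧ g ≫ g' = 𝟙 W :=
    ⟨e.hom.left, e.inv.left, e.hom.right, e.inv.right, e.hom.w.symm, e.inv.w.symm,
      congrArg CommaMorphism.right e.hom_inv_id⟩
  have hφ : (Ind.lim I).map φ ≫ (Ind.lim I).map q = 0 := by
    rw [← Functor.map_comp, cokernel.condition, Functor.map_zero]
  obtain ⟨d, hd⟩ : ∃ d, c.π ≫ d = g ≫ (Ind.lim I).map q :=
    ⟨_, hc.fac (CokernelCofork.ofπ (g ≫ (Ind.lim I).map q) (by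
      rw [reassoc_of% h1, hφ, comp_zero])) WalkingParallelPair.one⟩
  obtain ⟨d', hd'⟩ : ∃ d', (Ind.lim I).map q ≫ d' = g' ≫ c.π :=
    ⟨_, hq.fac (CokernelCofork.ofπ (g' ≫ c.π) (by
      rw [reassoc_of% h2, CokernelCofork.condition, comp_zero])) WalkingParallelPair.one⟩
  have hdd : d ≫ d' = 𝟙 c.pt := Cofork.IsColimit.hom_ext hc (by
    rw [reassoc_of% hd, hd', reassoc_of% h3, Category.comp_id])
  -- By compactness the element lives at one level `i`, where the cokernel projection is a strict
  -- epimorphism of Banach modules.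
  obtain ⟨i, z, hz⟩ := exists_comp_ι_app_eq (colimit.isColimit (cokernel φ ⋙ Ind.yoneda)) (x ≫ d)
  change Ind.yoneda.obj P ⟶ Ind.yoneda.obj ((cokernel φ).obj i) at z
  obtain ⟨p, rfl⟩ := Ind.yoneda.map_surjective z
  have hqi : StrictSurj (q.app i) := strictSurj_of_isColimit _
    (CokernelCofork.mapIsColimit _ (cokernelIsCokernel φ) ((evaluation I (BanMod R)).obj i))
  obtain ⟨r, rfl⟩ := hP.exists_lift hqi p
  obtain ⟨a, b, hab, hb⟩ : ∃ (a : Ind.yoneda.obj (G.obj i) ⟶ (Ind.lim I).obj G)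
      (b : Ind.yoneda.obj ((cokernel φ).obj i) ⟶ (Ind.lim I).obj (cokernel φ)),
      a ≫ (Ind.lim I).map q = Ind.yoneda.map (q.app i) ≫ b ∧
        Ind.yoneda.map (r ≫ q.app i) ≫ b = x ≫ d :=
    ⟨colimit.ι (G ⋙ Ind.yoneda) i, colimit.ι (cokernel φ ⋙ Ind.yoneda) i, ι_colimMap _ _, hz⟩
  refine ⟨Ind.yoneda.map r ≫ a ≫ g', ?_⟩
  rw [Category.assoc, Category.assoc, ← hd', reassoc_of% hab, ← Category.assoc,
    ← Functor.map_comp, reassoc_of% hb, hdd, Category.comp_id]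

/-- Every Banach module is the cokernel of a map between strictly projective ones, so bijectivity on
those passes to all Banach modules. -/
lemma isIso_of_bijective_comp_strictProjective [IsUltrametricDist R] [CompleteSpace R]
    {V W : IndBan R} (j : V ⟶ W) (h : ∀ P : BanMod R, StrictProjective P →
      Function.Bijective fun x : Ind.yoneda.obj P ⟶ V => x ≫ j) : IsIso j := by
  refine isIso_of_bijective_comp j fun A => ?_
  obtain ⟨P, p, hP, hp⟩ := exists_strictProjective_cover A
  obtain ⟨Q, q, hQ, hq⟩ := exists_strictProjective_cover (ker p)
  have w : (q ≫ kerι p) ≫ p = 0 := by rw [Category.assoc, kerι_comp, comp_zero]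
  obtain ⟨hc⟩ := hp.nonempty_isColimit (q ≫ kerι p) w fun x hx => by
    obtain ⟨z, hz⟩ := hq.surjective ⟨x, hx⟩
    exact ⟨z, congrArg Subtype.val hz⟩
  have hc' := CokernelCofork.mapIsColimit _ hc (Ind.yoneda (C := BanMod R))
  have : Epi (Ind.yoneda.map p) := ⟨fun a b hab => Cofork.IsColimit.hom_ext hc' hab⟩
  constructor
  · intro a b hab
    rw [← cancel_epi (Ind.yoneda.map p)]
    refine (h P hP).1 ?_
    change _ ≫ _ = _ ≫ _ at hab
    simp only [Category.assoc, hab]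
  · intro b
    obtain ⟨x, hx⟩ := (h P hP).2 (Ind.yoneda.map p ≫ b)
    change x ≫ j = _ at hx
    have hx0 : Ind.yoneda.map (q ≫ kerι p) ≫ x = 0 := by
      refine (h Q hQ).1 ?_
      change _ ≫ _ = _ ≫ _
      rw [Category.assoc, hx, ← Category.assoc, ← Functor.map_comp, w, Functor.map_zero, zero_comp,
        zero_comp]
    obtain ⟨a, ha⟩ : ∃ a, Ind.yoneda.map p ≫ a = x :=
      ⟨_, hc'.fac (CokernelCofork.ofπ x hx0) WalkingParallelPair.one⟩
    refine ⟨a, ?_⟩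
    change a ≫ j = b
    rw [← cancel_epi (Ind.yoneda.map p), reassoc_of% ha, hx]

/-- Strict exactness identifies the kernel of `S.g` with the coimage of `S.f`, a cokernel along
which maps from `P` lift. -/
lemma isExactOn_of_isStrictlyExact {P : BanMod R} (hP : StrictProjective P)
    {S : ShortComplex (IndBan R)} (hS : IsStrictlyExact S) :
    IsExactOn (Ind.yoneda.obj P) S := fun x hx => by
  obtain ⟨hf, hg⟩ := hS
  have : IsIso (Abelian.coimageImageComparison S.f) := hf
  obtain ⟨y, hy⟩ := exists_lift_of_isColimit hP _ (cokernelIsCokernel (kernel.ι S.f))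
    (kernel.lift S.g x hx ≫ inv (kernel.lift S.g (Abelian.image.ι S.f) _) ≫
      inv (Abelian.coimageImageComparison S.f))
  change y ≫ Abelian.coimage.π S.f = _ at hy
  refine ⟨y, ?_⟩
  have e : inv (kernel.lift S.g (Abelian.image.ι S.f) _) ≫ Abelian.image.ι S.f = kernel.ι S.g :=
    (IsIso.inv_comp_eq _).2 (kernel.lift_ι _ _ _).symm
  rw [← Abelian.coimage_image_factorisation S.f, reassoc_of% hy, IsIso.inv_hom_id_assoc, e,
    kernel.lift_ι]

/-- The map `j` from the coimage of `S.f` to the kernel of `S.g` is bijective on elements from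
strictly projectives, hence invertible. Its second factor `l` is then a split epimorphism, and it is
monic, so both factors are invertible. -/
lemma isStrictlyExact_of_isExactOn [IsUltrametricDist R] [CompleteSpace R]
    {S : ShortComplex (IndBan R)} (hS : ∀ P : BanMod R, StrictProjective P →
      IsExactOn (Ind.yoneda.obj P) S) : IsStrictlyExact S := by
  have w : Abelian.image.ι S.f ≫ S.g = 0 := by
    rw [← cokernel.π_desc S.f S.g S.zero, kernel.condition_assoc, zero_comp]
  let l := kernel.lift S.g (Abelian.image.ι S.f) w
  let j := Abelian.coimageImageComparison S.f ≫ l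
  have hl : l ≫ kernel.ι S.g = Abelian.image.ι S.f := kernel.lift_ι _ _ _
  have hj : Abelian.coimage.π S.f ≫ j ≫ kernel.ι S.g = S.f := by
    rw [Category.assoc, hl, Abelian.coimage_image_factorisation]
  have hiso : IsIso j := by
    refine isIso_of_bijective_comp_strictProjective j fun P hP => ⟨fun a b hab => ?_, fun t => ?_⟩
    · change _ ≫ _ = _ ≫ _ at hab
      obtain ⟨y, hy⟩ := exists_lift_of_isColimit hP _ (cokernelIsCokernel (kernel.ι S.f)) (a - b)
      change y ≫ Abelian.coimage.π S.f = _ at hy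
      have hy0 : y ≫ S.f = 0 := by
        rw [← hj, reassoc_of% hy, ← Category.assoc, Preadditive.sub_comp, hab, sub_self, zero_comp]
      rw [← sub_eq_zero, ← hy, ← kernel.lift_ι S.f y hy0, Category.assoc]
      erw [cokernel.condition]
      rw [comp_zero]
    · obtain ⟨y, hy⟩ := hS P hP (t ≫ kernel.ι S.g) (by
        rw [Category.assoc, kernel.condition, comp_zero])
      refine ⟨y ≫ Abelian.coimage.π S.f, ?_⟩
      change (y ≫ Abelian.coimage.π S.f) ≫ j = t
      rw [← cancel_mono (kernel.ι S.g), ← hy, Category.assoc, Category.assoc, hj]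
  have : Mono l := by
    have : Mono (l ≫ kernel.ι S.g) := by rw [hl]; infer_instance
    exact mono_of_mono l (kernel.ι S.g)
  have : IsSplitEpi l := ⟨⟨⟨inv j ≫ Abelian.coimageImageComparison S.f, by
    rw [Category.assoc]; exact IsIso.inv_hom_id j⟩⟩⟩
  have hl' : IsIso l := isIso_of_mono_of_isSplitEpi l
  exact ⟨IsIso.of_isIso_comp_right (Abelian.coimageImageComparison S.f) l, hl'⟩

instance [IsUltrametricDist R] [CompleteSpace R] : HasStrictGenerators (IndBan R) where
  gen V := ∃ P : BanMod R, StrictProjective P ∧ V = Ind.yoneda.obj P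
  isStrictlyExact_iff S := by
    refine ⟨?_, fun h => isStrictlyExact_of_isExactOn fun P hP => h _ ⟨P, hP, rfl⟩⟩
    rintro h _ ⟨P, hP, rfl⟩
    exact isExactOn_of_isStrictlyExact hP h

instance (V : IndBan R) : IsFiltered (CostructuredArrow (Ind.yoneda (C := BanMod R)) V) :=
  RepresentablyCoflat.filtered V

lemma exists_map_comp_ι {M P : BanMod R} {V : IndBan R}
    (x : Ind.yoneda.obj P ⟶ (ihomFunctor M).obj V) :
    ∃ (A : BanMod R) (a : Ind.yoneda.obj A ⟶ V)
      (p : P ⟶ (BanMod.ihomFunctor M).obj A),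
      Ind.yoneda.map p ≫ ι M a = x := by
  obtain ⟨j, y, hy⟩ := exists_comp_ι_app_eq (colimit.isColimit
    (CostructuredArrow.proj Ind.yoneda V ⋙ BanMod.ihomFunctor M ⋙ Ind.yoneda)) x
  change Ind.yoneda.obj P ⟶ Ind.yoneda.obj ((BanMod.ihomFunctor M).obj j.left) at y
  obtain ⟨p, rfl⟩ := Ind.yoneda.map_surjective y
  exact ⟨j.left, j.hom, p, hy⟩

lemma exists_comp_ihomMap_eq_zero {M P A : BanMod R} {V : IndBan R} {a : Ind.yoneda.obj A ⟶ V}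
    {p : P ⟶ (BanMod.ihomFunctor M).obj A} (h : Ind.yoneda.map p ≫ ι M a = 0) :
    ∃ (B : BanMod R) (k : A ⟶ B) (b : Ind.yoneda.obj B ⟶ V),
      Ind.yoneda.map k ≫ b = a ∧ p ≫ (BanMod.ihomFunctor M).map k = 0 := by
  obtain ⟨j, f, hf⟩ := exists_comp_map_eq (colimit.isColimit
    (CostructuredArrow.proj Ind.yoneda V ⋙ BanMod.ihomFunctor M ⋙ Ind.yoneda))
    (j := CostructuredArrow.mk a) (x := Ind.yoneda.map p) (y := 0) (by
      rw [zero_comp]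
      exact h)
  refine ⟨j.left, f.left, j.hom, CostructuredArrow.w f, Ind.yoneda.map_injective ?_⟩
  rw [zero_comp] at hf
  rw [Functor.map_comp, Functor.map_zero]
  exact hf

/-- The kernel carries the restricted norm, so the same bounds serve after restricting codomains. -/
lemma exists_lift_ihomMap_kerι {M P A B : BanMod R} {k : A ⟶ B} {p : P ⟶ ihom M A}
    (h : p ≫ ihomMap M k = 0) : ∃ p' : P ⟶ ihom M (ker k), p' ≫ ihomMap M (kerι k) = p := by
  have h0 : ∀ z x, k.toLin ((p.toLin z).1 x) = 0 := fun z x =>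
    LinearMap.congr_fun (congrArg Subtype.val (LinearMap.congr_fun (congrArg Hom.toLin h) z)) x
  refine ⟨⟨{ toFun z := ⟨LinearMap.codRestrict _ (p.toLin z).1 (h0 z), (p.toLin z).2⟩
             map_add' a b := ?_
             map_smul' r a := ?_ }, p.bounded⟩, rfl⟩
  · refine Subtype.ext (LinearMap.ext fun x => Subtype.ext ?_)
    change (p.toLin (a + b)).1 x = _
    rw [map_add]
    rfl
  · refine Subtype.ext (LinearMap.ext fun x => Subtype.ext ?_)
    change (p.toLin (r • a)).1 x = _
    rw [map_smul]
    rfl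

/-- The internal hom functor out of a strictly projective Banach module preserves strict
exactness. -/
theorem preservesStrictExactness_ihomFunctor [IsUltrametricDist R] [CompleteSpace R]
    {M : BanMod R} (hM : StrictProjective M) : PreservesStrictExactness (ihomFunctor M) := by
  intro S hS
  refine isStrictlyExact_of_isExactOn fun P hP x hx => ?_
  obtain ⟨A, a, p, rfl⟩ := exists_map_comp_ι x
  change (_ ≫ _) ≫ (ihomFunctor M).map S.g = 0 at hx
  rw [Category.assoc, ι_map] at hx
  -- The cocycle condition on `x` already holds at a finite stage `k : A ⟶ B`, so `p` takes values
  -- in Hom(M, ker k).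
  obtain ⟨B, k, b, hk, hp⟩ := exists_comp_ihomMap_eq_zero hx
  obtain ⟨p', rfl⟩ := exists_lift_ihomMap_kerι hp
  obtain ⟨T, q, hT, hq⟩ := exists_strictProjective_cover (ker k)
  -- Exactness of `S` applies to elements with strictly projective source, hence the cover `T` of
  -- `ker k`.
  obtain ⟨t, ht⟩ := isExactOn_of_isStrictlyExact hT hS (Ind.yoneda.map (q ≫ kerι k) ≫ a) (by
    rw [Category.assoc, ← hk, ← Category.assoc, ← Functor.map_comp, Category.assoc, kerι_comp,
      comp_zero, Functor.map_zero, zero_comp])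
  -- Both projectivities enter: that of `M` makes Hom(M, T) ⟶ Hom(M, ker k) a strict epimorphism,
  -- and that of `P` lifts `p'` along it.
  obtain ⟨r, rfl⟩ := hP.exists_lift (hM q hq) p'
  change P ⟶ (BanMod.ihomFunctor M).obj T at r
  refine ⟨Ind.yoneda.map r ≫ ι M t, ?_⟩
  change (_ ≫ _) ≫ (ihomFunctor M).map S.f = _
  rw [Category.assoc, ι_map, ht, ← map_ι M (q ≫ kerι k) a _ rfl]
  change _ = Ind.yoneda.map (r ≫ (BanMod.ihomFunctor M).map q ≫
    (BanMod.ihomFunctor M).map (kerι k)) ≫ ι M a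
  simp only [Functor.map_comp, Category.assoc]

end IndBan

end IndBanach

end

/-! ### The proposition -/

theorem proposition5p4 {F : Type u} [NontriviallyNormedField F] [IsUltrametricDist F]
    [CompleteSpace F] (π : F) (hπ : π ≠ 0) (hπ' : ‖π‖ < 1) (m d : ℕ) :
    (∃ H : IndBanach.LH (IndBanach.IndBan (IndBanach.integers F)) ⥤
        IndBanach.LH (IndBanach.IndBan (IndBanach.integers F)),
      IndBanach.IsInternalHom (IndBanach.tate hπ m d) H) ∧
    ∀ H : IndBanach.LH (IndBanach.IndBan (IndBanach.integers F)) ⥤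
        IndBanach.LH (IndBanach.IndBan (IndBanach.integers F)),
      IndBanach.IsInternalHom (IndBanach.tate hπ m d) H →
        PreservesFiniteLimits H ∧ PreservesFiniteColimits H := by
  have hF := IndBanach.IndBan.preservesStrictExactness_ihomFunctor
    (IndBanach.strictProjective_tate hπ m d)
  refine ⟨?_, ?_⟩
  · obtain ⟨H, RHom, α, hα, hH⟩ := hF.exists_isLeftCohomologyZero
    exact ⟨H, RHom, α, hα, hH⟩
  · rintro H ⟨RHom, α, hα, hH⟩
    exact hF.preservesFiniteLimits_and_colimits hα hH
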